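/- **Setting.** Let $d\ge 2$, $n\ge 0$ and $D=d^n$. A measurement on $n$ qudits is $M=\{M_i\}_{i\in\mathbb N}$ with operators $M_i$ on $(\mathbb C^d)^{\otimes n}$, only finitely many of them nonzero, and $\sum_i M_i^\dagger M_i=I$; on a state $\rho$ it gives outcome $i$ with probability $\mathrm{tr}(M_i\rho M_i^\dagger)$ and leaves the (unnormalized) state $M_i\rho M_i^\dagger$. Put $\Delta(A,B)=\inf_{|\beta|=1}\frac1{\sqrt{2D}}\|A-\beta B\|_F$ for operators and $\Delta(M,N)=\big(\sum_i\Delta(M_i,N_i)^2\big)^{1/2}$ for measurements. A measurement $M$ is $\epsilon$-far from a set $\mathcal S$ of measurements if $\Delta(M,N)\ge\epsilon$ for all $N\in\mathcal S$. Each $\tau\in S_n$ acts on $(\mathbb C^d)^{\otimes n}$ by $\tau|\phi_1,\dots,\phi_n\rangle=|\phi_{\tau^{-1}(1)},\dots,\phi_{\tau^{-1}(n)}\rangle$; an operator $A$ is permutation-invariant if $A=\tau A\tau^\dagger$ for all $\tau\in S_n$, and $M$ is permutation-invariant if every $M_i$ is. Let $\hat A=\frac1{n!}\sum_{\tau\in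 S_n}\tau A\tau^\dagger$ be the permutation-invariant component of $A$, i.e. its Hilbert–Schmidt-orthogonal projection onto the space of permutation-invariant operators. An algorithm with black-box access to $M$ $\epsilon$-tests $\mathcal S$ with $q$ queries if, on every measurement $M$, it applies $M$ at most $q$ times (to the $n$-qudit part of states that may be entangled with ancillas, using outcomes and post-measurement states), accepts with probability at least $2/3$ if $M\in\mathcal S$, and accepts with probability at most $1/3$ if $M$ is $\epsilon$-far from $\mathcal S$. **Theorem.** The permutation-invariant measurements on $n$ qudits can be $\epsilon$-tested with $O(1/\epsilon^2)$ queries by an efficient algorithm. Precisely: there are a single quantum program, an absolute constant $C$ and a polynomial $P$ such that for all $d\ge2$, $n\ge 0$ and $0<\epsilon\le1$ there is a natural number $L\le C/\epsilon^2$ for which the program, on input $(n,d,\lceil1/\epsilon\rceil)$ and with black-box access to an unknown measurement $M$ on $n$ qudits, $\epsilon$-tests the permutation-invariant measurements with $L$ queries, runs in time at most $P(\log_2 D,1/\epsilon)$ (a query counting as one unit of time), and accepts $M$ with probability exactly $$\Big(\frac1D\sum_i\|\hat M_i\|_F^2\Big)^{L}.$$ Here a program uses classical registers for natural numbers, qudits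 of dimension $d$ and quantum integer registers. Its elementary steps are: setting a register to a constant, addition and truncated subtraction of registers; the Fourier transform on one qudit; the gate $|x\rangle|y\rangle\mapsto|x\rangle|y+x \bmod d\rangle$ on two different qudits; exchanging two qudits conditioned on the value of a quantum integer; the Fourier transform on the levels $0,\dots,m-1$ of a quantum integer (counted as $m+1$ units of time); measuring or resetting a qudit; testing whether a quantum integer has a given value; and a query. Control structures are sequencing, branching on whether a register is zero, and loops repeated as often as the value of a register says; each elementary step, branching and loop iteration (and each start of a loop) takes one unit of time, apart from the exception above. -/

import Mathlib

noncomputable section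

namespace QMeasTest

/-! ## Operators and measurements on `n` qudits of dimension `d` -/

/-- Labels `(i_1, …, i_n)` of the standard basis of `(ℂ^d)^{⊗n}`. -/
abbrev Idx (d n : ℕ) : Type := Fin n → Fin d

/-- Operators on `(ℂ^d)^{⊗n}`, in the standard basis. -/
abbrev Op (d n : ℕ) : Type := Matrix (Idx d n) (Idx d n) ℂ

/-- The dimension `D = d^n`. -/
def dimD (d n : ℕ) : ℝ := (d : ℝ) ^ n

/-- The squared Frobenius norm. -/
def frobSq {d n : ℕ} (A : Op d n) : ℝ := ∑ i, ∑ j, ‖A i j‖ ^ 2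

/-- The Frobenius norm. -/
def frob {d n : ℕ} (A : Op d n) : ℝ := Real.sqrt (frobSq A)

/-- A measurement with finitely many outcomes, given by its Kraus operators and padded with zero
operators to a family indexed by `ℕ`. -/
structure Measurement (d n : ℕ) where
  /-- the number of possible outcomes `0, …, outcomes - 1` -/
  outcomes : ℕ
  kraus : ℕ → Op d n
  kraus_eq_zero : ∀ i, outcomes ≤ i → kraus i = 0
  complete : ∑ i ∈ Finset.range outcomes, (kraus i).conjTranspose * kraus i = 1

/-- The distance of two operators: the infimum over phases `β` of `‖A - β B‖_F / √(2D)`. -/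
def opDist {d n : ℕ} (A B : Op d n) : ℝ :=
  ⨅ β : Circle, 1 / Real.sqrt (2 * dimD d n) * frob (A - (β : ℂ) • B)

/-- The distance of two measurements. -/
def measDist {d n : ℕ} (M N : Measurement d n) : ℝ :=
  Real.sqrt (∑ i ∈ Finset.range (max M.outcomes N.outcomes), opDist (M.kraus i) (N.kraus i) ^ 2)

/-- `M` is `ε`-far from the property `S`. -/
def IsFar {d n : ℕ} (ε : ℝ) (M : Measurement d n) (S : Set (Measurement d n)) : Prop :=
  ∀ N ∈ S, ε ≤ measDist M N

/-- The unitary `|φ_1, …, φ_n⟩ ↦ |φ_{τ⁻¹(1)}, …, φ_{τ⁻¹(n)}⟩`. -/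
def permOp (d : ℕ) {n : ℕ} (τ : Equiv.Perm (Fin n)) : Op d n :=
  fun x y => if x = fun k => y (τ⁻¹ k) then 1 else 0

def PermInv {d n : ℕ} (A : Op d n) : Prop :=
  ∀ τ : Equiv.Perm (Fin n), A = permOp d τ * A * (permOp d τ).conjTranspose

/-- The permutation-invariant measurements on `n` qudits. -/
def permInvMeasurements (d n : ℕ) : Set (Measurement d n) :=
  {M | ∀ i, PermInv (M.kraus i)}

/-- The permutation-invariant component of `A`. By the two theorems that follow it is the
orthogonal projection of `A` to the space of permutation-invariant operators, for the
Hilbert-Schmidt inner product. -/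
def permInvComponent {d n : ℕ} (A : Op d n) : Op d n :=
  ((n.factorial : ℂ)⁻¹) • ∑ τ : Equiv.Perm (Fin n), permOp d τ * A * (permOp d τ).conjTranspose

theorem permOp_mul {d n : ℕ} (σ τ : Equiv.Perm (Fin n)) :
    permOp d σ * permOp d τ = permOp d (σ * τ) := by
  ext x y
  simp [permOp, Matrix.mul_apply, mul_inv_rev]

theorem permOp_conjTranspose {d n : ℕ} (τ : Equiv.Perm (Fin n)) :
    (permOp d τ).conjTranspose = permOp d τ⁻¹ := by
  ext x y
  have h : (y = fun k => x (τ⁻¹ k)) ↔ (x = fun k => y (τ k)) := by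
    constructor
    · rintro rfl; funext k; simp
    · rintro rfl; funext k; simp
  simp only [permOp, Matrix.conjTranspose_apply, inv_inv, h]
  split_ifs <;> simp

theorem permInvComponent_permInv {d n : ℕ} (A : Op d n) : PermInv (permInvComponent A) := by
  intro σ
  have key : ∀ τ : Equiv.Perm (Fin n),
      permOp d σ * (permOp d τ * A * (permOp d τ).conjTranspose) * (permOp d σ).conjTranspose =
      permOp d (σ * τ) * A * (permOp d (σ * τ)).conjTranspose := by
    intro τ
    rw [← permOp_mul, Matrix.conjTranspose_mul]
    simp only [Matrix.mul_assoc]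
  have hsum := Equiv.sum_comp (Equiv.mulLeft σ)
    fun τ => permOp d τ * A * (permOp d τ).conjTranspose
  simp only [Equiv.coe_mulLeft] at hsum
  rw [permInvComponent, Matrix.mul_smul, Matrix.smul_mul, Finset.mul_sum, Finset.sum_mul]
  simp only [key]
  rw [hsum]

theorem permInvComponent_orthogonal {d n : ℕ} (A B : Op d n) (hB : PermInv B) :
    Matrix.trace (B.conjTranspose * (A - permInvComponent A)) = 0 := by
  have key : ∀ τ : Equiv.Perm (Fin n), Matrix.trace
      (B.conjTranspose * (permOp d τ * A * (permOp d τ).conjTranspose)) =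
      Matrix.trace (B.conjTranspose * A) := by
    intro τ
    have h := congrArg Matrix.conjTranspose (hB τ⁻¹)
    simp only [Matrix.conjTranspose_mul, permOp_conjTranspose, inv_inv] at h
    rw [permOp_conjTranspose]
    conv_rhs => rw [h]
    rw [← Matrix.mul_assoc, Matrix.trace_mul_comm]
    simp only [Matrix.mul_assoc]
  have hn : (n.factorial : ℂ) ≠ 0 := by exact_mod_cast n.factorial_ne_zero
  simp only [permInvComponent, Matrix.mul_sub, Matrix.trace_sub, Matrix.mul_smul,
    Matrix.trace_smul, Finset.mul_sum, Matrix.trace_sum, key, Finset.sum_const,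
    Finset.card_univ, Fintype.card_perm, Fintype.card_fin, nsmul_eq_mul, smul_eq_mul]
  rw [inv_mul_cancel_left₀ hn, sub_self]

/-! ## Quantum programs with black-box access to a measurement

The machine has classical registers that hold natural numbers, an unlimited row of qudits of
dimension `d`, and an unlimited row of quantum integers (basis states `|0⟩, |1⟩, |2⟩, …`). A state
of the quantum memory is a finite linear combination of basis states; in the course of a run it
stays unnormalized, so that the squared norm of the state of a branch is the probability of that
branch. The black box is applied to the first `n` qudits. -/

/-- Basis states of the quantum memory: the values of the qudits and of the quantum integers. -/
abbrev QBasis (d : ℕ) : Type := (ℕ → Fin d) × (ℕ → ℕ)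

/-- Unnormalized states of the quantum memory. -/
abbrev QState (d : ℕ) : Type := QBasis d →₀ ℂ

def QState.normSq {d : ℕ} (ψ : QState d) : ℝ := ψ.sum fun _ a => ‖a‖ ^ 2

/-- The linear map with the given values on the basis states. -/
def linExt {d : ℕ} (f : QBasis d → QState d) (ψ : QState d) : QState d :=
  ψ.sum fun b a => a • f b

/-- The matrix entry `exp(2πi x y / m) / √m` of the Fourier transform of dimension `m`. -/
def fourierEntry (m x y : ℕ) : ℂ :=
  Complex.exp (2 * Real.pi * Complex.I * (x : ℂ) * (y : ℂ) / (m : ℂ)) / (Real.sqrt m : ℂ)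

/-- The Fourier transform of dimension `d` on qudit `j`. -/
def fourierQudit {d : ℕ} (j : ℕ) : QState d → QState d :=
  linExt fun b => ∑ y : Fin d,
    Finsupp.single (Function.update b.1 j y, b.2) (fourierEntry d (b.1 j) y)

/-- The gate `|x⟩|y⟩ ↦ |x⟩|y + x mod d⟩` on two different qudits `j`, `l`
(nothing happens if `j = l`). -/
def sumQudits {d : ℕ} (j l : ℕ) : QState d → QState d :=
  linExt fun b =>
    if j = l then Finsupp.single b 1
    else Finsupp.single (Function.update b.1 l (b.1 l + b.1 j), b.2) 1

/-- Exchange the qudits `j` and `l` if the quantum integer `c` has the value `v`. -/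
def cswapQudits {d : ℕ} (c v j l : ℕ) : QState d → QState d :=
  linExt fun b =>
    if b.2 c = v then Finsupp.single (fun k => b.1 (Equiv.swap j l k), b.2) 1
    else Finsupp.single b 1

/-- The Fourier transform of dimension `m` on the levels `0, …, m - 1` of the quantum integer `c`;
the other levels are left alone. -/
def fourierInt {d : ℕ} (c m : ℕ) : QState d → QState d :=
  linExt fun b =>
    if b.2 c < m then ∑ y ∈ Finset.range m,
      Finsupp.single (b.1, Function.update b.2 c y) (fourierEntry m (b.2 c) y)
    else Finsupp.single b 1

/-- Projection to the span of the basis states in which qudit `j` has the value `y`. -/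
def projQudit {d : ℕ} (j : ℕ) (y : Fin d) (ψ : QState d) : QState d :=
  ψ.filter fun b => b.1 j = y

/-- Put qudit `j` in the basis state `|y⟩` (used after a projection to a basis state). -/
def setQudit {d : ℕ} (j : ℕ) (y : Fin d) : QState d → QState d :=
  linExt fun b => Finsupp.single (Function.update b.1 j y, b.2) 1

/-- Replace the values of the first `n` qudits. -/
def overwrite {d n : ℕ} (q : ℕ → Fin d) (x : Idx d n) : ℕ → Fin d :=
  fun k => if h : k < n then x ⟨k, h⟩ else q k

/-- The operator `A` on the first `n` qudits, tensored with the identity on the rest. -/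
def applyOp {d n : ℕ} (A : Op d n) : QState d → QState d :=
  linExt fun b => ∑ x : Idx d n,
    Finsupp.single (overwrite b.1 x, b.2) (A x fun k => b.1 k)

/-- Programs. All arguments are names of classical registers, except the numeral of `const`;
qudits and quantum integers are addressed by the value of the register named. -/
inductive Prog : Type
  | skip : Prog
  /-- `x := v` -/
  | const (x v : ℕ) : Prog
  /-- `x := y + z` -/
  | add (x y z : ℕ) : Prog
  /-- `x := y - z`, cut off at `0` -/
  | sub (x y z : ℕ) : Prog
  /-- Fourier transform on qudit `j` -/
  | fourierQ (j : ℕ) : Prog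
  /-- add qudit `j` to qudit `l` -/
  | sumQ (j l : ℕ) : Prog
  /-- exchange qudits `j`, `l` if quantum integer `c` has the value `v` -/
  | cswapQ (c v j l : ℕ) : Prog
  /-- Fourier transform of dimension `m` on quantum integer `c` -/
  | fourierI (c m : ℕ) : Prog
  /-- measure qudit `j` in the standard basis and store the outcome in `x` -/
  | measQ (j x : ℕ) : Prog
  /-- measure qudit `j` in the standard basis, forget the outcome, and set the qudit to `|0⟩` -/
  | resetQ (j : ℕ) : Prog
  /-- measure whether quantum integer `c` has the value `v`, and store `1` (yes) or `0` (no)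
  in `x` -/
  | testI (c v x : ℕ) : Prog
  /-- apply the black box to the first `n` qudits and store the outcome in `x` -/
  | query (x : ℕ) : Prog
  | seq (p q : Prog) : Prog
  /-- `p` if the register `x` is `0`, otherwise `q` -/
  | ifZero (x : ℕ) (p q : Prog) : Prog
  /-- execute `p` as many times as the value of `x` at the start -/
  | loop (x : ℕ) (p : Prog) : Prog

/-- One branch of a run: the registers, the unnormalized state of the quantum memory, the time used
and the number of queries made. -/
structure Config (d : ℕ) where
  reg : ℕ → ℕ
  state : QState d
  time : ℕ
  queries : ℕ

/-- Let `t` units of time pass. -/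
def Config.tick {d : ℕ} (c : Config d) (t : ℕ) : Config d := { c with time := c.time + t }

/-- Assign to a register (one unit of time). -/
def Config.assign {d : ℕ} (c : Config d) (x v : ℕ) : Config d :=
  { c.tick 1 with reg := Function.update c.reg x v }

/-- Replace the state of the quantum memory (`t` units of time). -/
def Config.apply {d : ℕ} (c : Config d) (t : ℕ) (f : QState d → QState d) : Config d :=
  { c.tick t with state := f c.state }

/-- The branches of the run of a program with black box `M`, one for each sequence of measurement
outcomes. Every elementary step takes one unit of time, in particular a query; but the Fourier
transform of dimension `m` on a quantum integer takes `m + 1` units. -/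
def run {d n : ℕ} [NeZero d] (M : Measurement d n) : Prog → Config d → List (Config d)
  | .skip, c => [c.tick 1]
  | .const x v, c => [c.assign x v]
  | .add x y z, c => [c.assign x (c.reg y + c.reg z)]
  | .sub x y z, c => [c.assign x (c.reg y - c.reg z)]
  | .fourierQ j, c => [c.apply 1 (fourierQudit (c.reg j))]
  | .sumQ j l, c => [c.apply 1 (sumQudits (c.reg j) (c.reg l))]
  | .cswapQ q v j l, c => [c.apply 1 (cswapQudits (c.reg q) (c.reg v) (c.reg j) (c.reg l))]
  | .fourierI q m, c => [c.apply (c.reg m + 1) (fourierInt (c.reg q) (c.reg m))]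
  | .measQ j x, c =>
      (List.finRange d).map fun y => (c.apply 0 (projQudit (c.reg j) y)).assign x y
  | .resetQ j, c =>
      (List.finRange d).map fun y =>
        c.apply 1 fun ψ => setQudit (c.reg j) 0 (projQudit (c.reg j) y ψ)
  | .testI q v x, c =>
      [(c.apply 0 fun ψ => ψ.filter fun b => b.2 (c.reg q) = c.reg v).assign x 1,
       (c.apply 0 fun ψ => ψ.filter fun b => b.2 (c.reg q) ≠ c.reg v).assign x 0]
  | .query x, c =>
      (List.range M.outcomes).map fun i =>
        { (c.apply 0 (applyOp (M.kraus i))).assign x i with queries := c.queries + 1 }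
  | .seq p q, c => (run M p c).flatMap (run M q)
  | .ifZero x p q, c => if c.reg x = 0 then run M p (c.tick 1) else run M q (c.tick 1)
  | .loop x p, c =>
      (fun l : List (Config d) => l.flatMap fun c' => run M p (c'.tick 1))^[c.reg x] [c.tick 1]

/-- The start: registers `0`, `1`, `2` hold `n`, `d` and the accuracy parameter `⌈1/ε⌉`, the other
registers hold `0`, and the quantum memory is in the state in which all qudits and all quantum
integers are `|0⟩`. -/
def initConfig (d n : ℕ) [NeZero d] (ε : ℝ) : Config d where
  reg := fun x => if x = 0 then n else if x = 1 then d else if x = 2 then ⌈1 / ε⌉₊ else 0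
  state := Finsupp.single (fun _ => 0, fun _ => 0) 1
  time := 0
  queries := 0

/-- All branches of the run of `p` on the black box `M` with accuracy parameter `ε`. -/
def branches {d n : ℕ} [NeZero d] (p : Prog) (ε : ℝ) (M : Measurement d n) : List (Config d) :=
  run M p (initConfig d n ε)

/-- The probability that `p` accepts `M`, i.e. ends with register `0` equal to `1`. -/
def acceptProb {d n : ℕ} [NeZero d] (p : Prog) (ε : ℝ) (M : Measurement d n) : ℝ :=
  ((branches p ε M).map fun c => if c.reg 0 = 1 then c.state.normSq else 0).sum

/-- `p` makes at most `q` queries to `M`. -/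
def QueriesAtMost {d n : ℕ} [NeZero d] (p : Prog) (ε : ℝ) (M : Measurement d n) (q : ℕ) : Prop :=
  ∀ c ∈ branches p ε M, c.queries ≤ q

/-- `p` runs for at most `T` units of time on `M`. -/
def TimeAtMost {d n : ℕ} [NeZero d] (p : Prog) (ε : ℝ) (M : Measurement d n) (T : ℝ) : Prop :=
  ∀ c ∈ branches p ε M, (c.time : ℝ) ≤ T

/-- `p` `ε`-tests the property `S` with at most `q` queries. -/
def EpsTests {d n : ℕ} [NeZero d] (p : Prog) (ε : ℝ) (S : Set (Measurement d n)) (q : ℕ) : Prop :=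
  ∀ M : Measurement d n, QueriesAtMost p ε M q ∧
    (M ∈ S → 2 / 3 ≤ acceptProb p ε M) ∧
    (IsFar ε M S → acceptProb p ε M ≤ 1 / 3)

end QMeasTest

end

noncomputable section

namespace QMeasTest

open Matrix

/-! ## Soundness of the test -/

/-! One round of the test applies `M` to one half of `n` maximally entangled pairs of qudits.
Outcome `i` leaves the vector `∑ x y, Mᵢ x y |x⟩|y⟩ / √D`, so the memory holds the matrix of `Mᵢ`,
and conjugating `Mᵢ` by `τ` amounts to permuting the qudits of both halves by `τ`, since `permOp d
τ` is real. A control integer in uniform superposition, controlled permutations, and a projection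
back onto the uniform superposition replace `Mᵢ` by an average of conjugates. Every permutation of
`0, …, m` is uniquely `(v m) σ` with `v ≤ m` and `σ` fixing `m`, so `n` averages over transpositions
compose to the average over `S_n` (`swapAverages_eq_permInvComponent`). The surviving vector is `M̂ᵢ
/ √D`; a round therefore succeeds with probability `w = (1/D) ∑ ‖M̂ᵢ‖²` (`branchSum_roundProg`), and
`L` rounds on a freshly reset memory succeed with probability `w ^ L` (`acceptProb_testerProg`).

If `M` is invariant, then `w = 1`. In general `1 - ∑ M̂ᵢ† M̂ᵢ` is a sum of matrix variances, hence
positive semidefinite, and it has an invariant root `B`. The operators `M̂ᵢ` together with `B` form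
an invariant measurement at squared distance at most `1 - w` from `M`
(`exists_permInv_measDist_sq_le`). So `w ≤ 1 - ε²` when `M` is `ε`-far, and `L = 2⌈1/ε⌉²` rounds
push `w ^ L` below `e⁻² ≤ 1/3`.

The program is analysed backwards: `branchSum` turns a payoff after a program into the total payoff
before it. Branches that fail a test run on, but their flag stays `0` and they count nothing. -/

theorem frobSq_eq_trace {d n : ℕ} (A : Op d n) : (frobSq A : ℂ) = (Aᴴ * A).trace := by
  simp only [frobSq, Matrix.trace, Matrix.diag, Matrix.mul_apply, Matrix.conjTranspose_apply]
  push_cast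
  rw [Finset.sum_comm]
  refine Finset.sum_congr rfl fun i _ => Finset.sum_congr rfl fun j _ => ?_
  rw [Complex.star_def, Complex.conj_mul']

theorem frobSq_nonneg {d n : ℕ} (A : Op d n) : 0 ≤ frobSq A := by
  unfold frobSq; positivity

theorem frobSq_smul {d n : ℕ} (a : ℂ) (A : Op d n) : frobSq (a • A) = ‖a‖ ^ 2 * frobSq A := by
  simp [frobSq, mul_pow, Finset.mul_sum]

theorem permInvComponent_eq_self {d n : ℕ} {A : Op d n} (hA : PermInv A) :
    permInvComponent A = A := by
  have hn : (n.factorial : ℂ) ≠ 0 := by exact_mod_cast n.factorial_ne_zero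
  simp only [permInvComponent, ← hA _, Finset.sum_const, Finset.card_univ, Fintype.card_perm,
    Fintype.card_fin]
  rw [← Nat.cast_smul_eq_nsmul ℂ, smul_smul, inv_mul_cancel₀ hn, one_smul]

/-- Pythagoras: the cross terms are the orthogonality relation and its complex conjugate. -/
theorem frobSq_sub_permInvComponent {d n : ℕ} (A : Op d n) :
    frobSq (A - permInvComponent A) = frobSq A - frobSq (permInvComponent A) := by
  have h := permInvComponent_orthogonal A _ (permInvComponent_permInv A)
  have h' := congrArg star h
  rw [← Matrix.trace_conjTranspose] at h'
  simp only [Matrix.conjTranspose_mul, Matrix.conjTranspose_conjTranspose, star_zero] at h'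
  have : ((frobSq (A - permInvComponent A) : ℝ) : ℂ) =
      ((frobSq A - frobSq (permInvComponent A) : ℝ) : ℂ) := by
    push_cast
    simp only [frobSq_eq_trace]
    simp only [Matrix.conjTranspose_sub, Matrix.sub_mul, Matrix.mul_sub, Matrix.trace_sub] at h h' ⊢
    linear_combination -h - h'
  exact_mod_cast this

theorem Measurement.sum_frobSq {d n : ℕ} (M : Measurement d n) :
    ∑ i ∈ Finset.range M.outcomes, frobSq (M.kraus i) = dimD d n := by
  have : ((∑ i ∈ Finset.range M.outcomes, frobSq (M.kraus i) : ℝ) : ℂ) = (dimD d n : ℝ) := by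
    push_cast
    simp only [frobSq_eq_trace]
    rw [← Matrix.trace_sum, M.complete, Matrix.trace_one]
    simp [dimD]
  exact_mod_cast this

theorem permOp_mul_conjTranspose {d n : ℕ} (τ : Equiv.Perm (Fin n)) :
    permOp d τ * (permOp d τ)ᴴ = 1 := by
  rw [permOp_conjTranspose, permOp_mul, mul_inv_cancel]
  ext x y
  simp [permOp, Matrix.one_apply]

theorem permOp_conjTranspose_mul {d n : ℕ} (τ : Equiv.Perm (Fin n)) :
    (permOp d τ)ᴴ * permOp d τ = 1 := by
  rw [permOp_conjTranspose, permOp_mul, inv_mul_cancel]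
  ext x y
  simp [permOp, Matrix.one_apply]

/-- An operator is permutation-invariant iff it commutes with all `permOp d τ`. -/
theorem permInv_iff_commute {d n : ℕ} {A : Op d n} :
    PermInv A ↔ ∀ τ : Equiv.Perm (Fin n), Commute A (permOp d τ) := by
  refine forall_congr' fun τ => ⟨fun h => ?_, fun h => ?_⟩
  · rw [commute_iff_eq]
    conv_lhs => rw [h]
    rw [Matrix.mul_assoc, permOp_conjTranspose_mul, Matrix.mul_one]
  · rw [← h.eq, Matrix.mul_assoc, permOp_mul_conjTranspose, Matrix.mul_one]

/-! ### A permutation-invariant measurement close to `M` -/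

/-- The defect `1 - ∑ i, M̂ᵢ† M̂ᵢ` of the permutation-invariant components of a measurement. -/
def Measurement.defect {d n : ℕ} (M : Measurement d n) : Op d n :=
  1 - ∑ i ∈ Finset.range M.outcomes,
    (permInvComponent (M.kraus i))ᴴ * permInvComponent (M.kraus i)

/-- The matrix form of "variance = mean of the square minus square of the mean", for the conjugates
of `A` under a uniformly random permutation. -/
theorem sum_conj_sub_permInvComponent {d n : ℕ} (A : Op d n) :
    ((n.factorial : ℂ)⁻¹) • ∑ τ : Equiv.Perm (Fin n),
      (permOp d τ * A * (permOp d τ)ᴴ - permInvComponent A)ᴴ *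
        (permOp d τ * A * (permOp d τ)ᴴ - permInvComponent A) =
      permInvComponent (Aᴴ * A) - (permInvComponent A)ᴴ * permInvComponent A := by
  have hn : (n.factorial : ℂ) ≠ 0 := by exact_mod_cast n.factorial_ne_zero
  have hsum : ∑ τ : Equiv.Perm (Fin n), permOp d τ * A * (permOp d τ)ᴴ =
      (n.factorial : ℂ) • permInvComponent A := by
    rw [permInvComponent, smul_smul, mul_inv_cancel₀ hn, one_smul]
  have hsum' : ∑ τ : Equiv.Perm (Fin n), (permOp d τ * A * (permOp d τ)ᴴ)ᴴ =
      (n.factorial : ℂ) • (permInvComponent A)ᴴ := by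
    rw [← Matrix.conjTranspose_sum, hsum, Matrix.conjTranspose_smul]
    simp
  have hsq : ∀ τ : Equiv.Perm (Fin n), (permOp d τ * A * (permOp d τ)ᴴ)ᴴ *
      (permOp d τ * A * (permOp d τ)ᴴ) = permOp d τ * (Aᴴ * A) * (permOp d τ)ᴴ := by
    intro τ
    simp only [Matrix.conjTranspose_mul, Matrix.conjTranspose_conjTranspose]
    calc _ = permOp d τ * Aᴴ * ((permOp d τ)ᴴ * permOp d τ) * A * (permOp d τ)ᴴ := by
          simp only [Matrix.mul_assoc]
      _ = _ := by rw [permOp_conjTranspose_mul]; simp only [Matrix.mul_assoc, Matrix.one_mul]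
  simp only [Matrix.conjTranspose_sub, Matrix.sub_mul, Matrix.mul_sub, Finset.sum_sub_distrib, hsq,
    ← Finset.mul_sum, ← Finset.sum_mul, hsum, hsum', Finset.sum_const, Finset.card_univ,
    Fintype.card_perm, Fintype.card_fin]
  rw [← Nat.cast_smul_eq_nsmul ℂ, smul_sub, smul_sub, smul_sub, Matrix.mul_smul, Matrix.smul_mul]
  simp only [smul_smul, inv_mul_cancel₀ hn, one_smul, sub_self, sub_zero]
  rfl

theorem permInvComponent_sum {d n : ℕ} {ι : Type*} (s : Finset ι) (f : ι → Op d n) :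
    permInvComponent (∑ i ∈ s, f i) = ∑ i ∈ s, permInvComponent (f i) := by
  simp only [permInvComponent, Finset.mul_sum, Finset.sum_mul, ← Finset.smul_sum]
  rw [Finset.sum_comm]

theorem permInv_one {d n : ℕ} : PermInv (1 : Op d n) := fun τ => by
  rw [Matrix.mul_one, permOp_mul_conjTranspose]

-- By completeness and invariance of `1`, the components of the `Mᵢ† Mᵢ` add up to `1`; the defect
-- is thus a sum of the variances of the `Mᵢ`.
open scoped ComplexOrder in
theorem Measurement.defect_posSemidef {d n : ℕ} (M : Measurement d n) : M.defect.PosSemidef := by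
  have h : M.defect = ∑ i ∈ Finset.range M.outcomes, (permInvComponent ((M.kraus i)ᴴ * M.kraus i) -
      (permInvComponent (M.kraus i))ᴴ * permInvComponent (M.kraus i)) := by
    rw [Finset.sum_sub_distrib, ← permInvComponent_sum, M.complete,
      permInvComponent_eq_self permInv_one]
    rfl
  rw [h]
  refine Matrix.posSemidef_sum _ fun i _ => ?_
  rw [← sum_conj_sub_permInvComponent]
  refine Matrix.PosSemidef.smul (Matrix.posSemidef_sum _ fun τ _ =>
    Matrix.posSemidef_conjTranspose_mul_self _) ?_
  rw [inv_nonneg]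
  exact_mod_cast Nat.zero_le _

theorem PermInv.conjTranspose {d n : ℕ} {A : Op d n} (hA : PermInv A) : PermInv Aᴴ := fun τ => by
  conv_lhs => rw [hA τ]
  simp only [Matrix.conjTranspose_mul, Matrix.conjTranspose_conjTranspose, Matrix.mul_assoc]

theorem Measurement.defect_permInv {d n : ℕ} (M : Measurement d n) : PermInv M.defect := by
  rw [permInv_iff_commute]
  intro τ
  refine (Commute.one_left _).sub_left (Commute.sum_left _ _ _ fun i _ => Commute.mul_left ?_ ?_)
  · exact permInv_iff_commute.1 (permInvComponent_permInv _).conjTranspose τ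
  · exact permInv_iff_commute.1 (permInvComponent_permInv _) τ

open scoped ComplexOrder MatrixOrder Matrix.Norms.L2Operator in
/-- A positive semidefinite permutation-invariant operator has a permutation-invariant root. -/
theorem exists_permInv_root {d n : ℕ} {A : Op d n} (hA : A.PosSemidef) (hA' : PermInv A) :
    ∃ B : Op d n, PermInv B ∧ Bᴴ * B = A := by
  refine ⟨CFC.sqrt A, ?_, ?_⟩
  · rw [permInv_iff_commute] at hA' ⊢
    intro τ
    rw [CFC.sqrt_eq_cfc]
    -- The root is a continuous function of `A`, so it commutes with whatever commutes with `A`.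
    exact (hA' τ).cfc_nnreal _
  · have h0 : (0 : Op d n) ≤ A := hA.nonneg
    have := (CFC.sqrt_nonneg A).isSelfAdjoint
    rw [← Matrix.star_eq_conjTranspose, this.star_eq, CFC.sqrt_mul_sqrt_self A]

/-- The phase `β = 1` already gives a good enough bound on the infimum. -/
theorem opDist_sq_le {d n : ℕ} (A B : Op d n) :
    opDist A B ^ 2 ≤ 1 / (2 * dimD d n) * frobSq (A - B) := by
  have hD : 0 ≤ 2 * dimD d n := by unfold dimD; positivity
  have h0 : 0 ≤ opDist A B := Real.iInf_nonneg fun β => by unfold frob; positivity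
  have h1 : opDist A B ≤ 1 / Real.sqrt (2 * dimD d n) * frob (A - B) := by
    have := ciInf_le (f := fun β : Circle => 1 / Real.sqrt (2 * dimD d n) *
      frob (A - (β : ℂ) • B)) ⟨0, by rintro _ ⟨β, rfl⟩; unfold frob; positivity⟩ 1
    simpa [opDist] using this
  calc _ ≤ _ := pow_le_pow_left₀ h0 h1 2
    _ = _ := by rw [mul_pow, frob, Real.sq_sqrt (frobSq_nonneg _), div_pow, Real.sq_sqrt hD,
      one_pow]

/-- The probability that one round of the tester accepts. -/
def Measurement.invWeight {d n : ℕ} (M : Measurement d n) : ℝ :=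
  1 / dimD d n * ∑ i ∈ Finset.range M.outcomes, frobSq (permInvComponent (M.kraus i))

theorem Measurement.invWeight_nonneg {d n : ℕ} (M : Measurement d n) : 0 ≤ M.invWeight := by
  have : 0 ≤ dimD d n := by unfold dimD; positivity
  exact mul_nonneg (by positivity) (Finset.sum_nonneg fun i _ => frobSq_nonneg _)

theorem Measurement.invWeight_eq_one {d n : ℕ} [NeZero d] {M : Measurement d n}
    (hM : M ∈ permInvMeasurements d n) : M.invWeight = 1 := by
  have hD : dimD d n ≠ 0 := by simp [dimD, NeZero.ne d]
  rw [invWeight, Finset.sum_congr rfl fun i _ => by rw [permInvComponent_eq_self (hM i)],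
    M.sum_frobSq, one_div_mul_cancel hD]

/-- Some permutation-invariant measurement is close to `M` if `M.invWeight` is near to one. -/
theorem Measurement.exists_permInv_measDist_sq_le {d n : ℕ} [NeZero d] (M : Measurement d n) :
    ∃ N ∈ permInvMeasurements d n, measDist M N ^ 2 ≤ 1 - M.invWeight := by
  have hD : 0 < dimD d n := by unfold dimD; have := NeZero.pos d; positivity
  obtain ⟨B, hB, hBB⟩ := exists_permInv_root M.defect_posSemidef M.defect_permInv
  set S := ∑ i ∈ Finset.range M.outcomes, frobSq (permInvComponent (M.kraus i)) with hS
  have hfB : frobSq B = dimD d n - S := by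
    have : (frobSq B : ℂ) = ((dimD d n - S : ℝ) : ℂ) := by
      rw [frobSq_eq_trace, hBB, defect, Matrix.trace_sub, Matrix.trace_sum, Matrix.trace_one]
      simp only [← frobSq_eq_trace, hS]
      push_cast
      simp [dimD]
    exact_mod_cast this
  have hlt : ∀ i ∈ Finset.range M.outcomes, i ≠ M.outcomes := fun i hi =>
    (Finset.mem_range.1 hi).ne
  -- The root gets the index `M.outcomes`, the first one at which `M` is padded with zero, so it
  -- contributes its full norm to the distance.
  let N : Measurement d n :=
    { outcomes := M.outcomes + 1
      kraus := fun i => if i = M.outcomes then B else permInvComponent (M.kraus i)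
      kraus_eq_zero := fun i hi => by
        rw [if_neg (by omega), M.kraus_eq_zero i (by omega)]
        simp [permInvComponent]
      complete := by
        rw [Finset.sum_range_succ, if_pos rfl, hBB, defect,
          Finset.sum_congr rfl fun i hi => by rw [if_neg (hlt i hi)]]
        abel }
  refine ⟨N, fun i => ?_, ?_⟩
  · change PermInv (if i = M.outcomes then B else permInvComponent (M.kraus i))
    split_ifs
    · exact hB
    · exact permInvComponent_permInv _
  · rw [measDist, Real.sq_sqrt (by positivity)]
    have hmax : max M.outcomes N.outcomes = M.outcomes + 1 := max_eq_right (Nat.le_succ _)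
    rw [hmax]
    calc _ ≤ ∑ i ∈ Finset.range (M.outcomes + 1),
          1 / (2 * dimD d n) * frobSq (M.kraus i - N.kraus i) :=
          Finset.sum_le_sum fun i _ => opDist_sq_le _ _
      -- The differences `Mᵢ - M̂ᵢ` and the root each contribute `D - S`; the two together cancel
      -- the factor `2` in the normalization of the distance.
      _ = 1 / (2 * dimD d n) * ((dimD d n - S) + (dimD d n - S)) := by
          rw [← Finset.mul_sum, Finset.sum_range_succ]
          congr 2
          · rw [← M.sum_frobSq, hS, ← Finset.sum_sub_distrib]
            refine Finset.sum_congr rfl fun i hi => ?_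
            rw [← frobSq_sub_permInvComponent]
            exact congrArg (fun X => frobSq (M.kraus i - X)) (if_neg (hlt i hi))
          · rw [M.kraus_eq_zero _ le_rfl, ← hfB]
            simp [N, frobSq]
      _ = _ := by
          rw [invWeight, ← hS]
          field_simp
          ring

theorem Measurement.invWeight_le {d n : ℕ} [NeZero d] {M : Measurement d n} {ε : ℝ} (hε : 0 ≤ ε)
    (hM : IsFar ε M (permInvMeasurements d n)) : M.invWeight ≤ 1 - ε ^ 2 := by
  obtain ⟨N, hN, h⟩ := M.exists_permInv_measDist_sq_le
  have := pow_le_pow_left₀ hε (hM N hN) 2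
  linarith

theorem Measurement.invWeight_pow_le {d n : ℕ} [NeZero d] {M : Measurement d n} {ε : ℝ}
    (hε : 0 ≤ ε) (hM : IsFar ε M (permInvMeasurements d n)) {L : ℕ} (hL : 2 ≤ ε ^ 2 * L) :
    M.invWeight ^ L ≤ 1 / 3 := by
  have h1 : M.invWeight ≤ Real.exp (-ε ^ 2) :=
    (invWeight_le hε hM).trans (by linarith [Real.add_one_le_exp (-ε ^ 2)])
  calc _ ≤ Real.exp (-ε ^ 2) ^ L := pow_le_pow_left₀ M.invWeight_nonneg h1 L
    _ = Real.exp (-(ε ^ 2 * L)) := by rw [← Real.exp_nat_mul]; ring_nf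
    _ ≤ Real.exp (-2) := Real.exp_le_exp.2 (by linarith)
    -- `e² ≥ 1 + 2`.
    _ ≤ 1 / 3 := by
      rw [Real.exp_neg, one_div]
      exact inv_anti₀ (by norm_num) (by linarith [Real.add_one_le_exp 2])

/-! ## Running programs -/

/-- The sum of `g` over the final configurations of all branches. -/
def branchSum {d n : ℕ} [NeZero d] (M : Measurement d n) (p : Prog) (g : Config d → ℝ)
    (c : Config d) : ℝ :=
  ((run M p c).map g).sum

theorem sum_map_flatMap {α β : Type*} (l : List α) (f : α → List β) (g : β → ℝ) :
    ((l.flatMap f).map g).sum = (l.map fun a => ((f a).map g).sum).sum := by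
  induction l with
  | nil => rfl
  | cons a l ih => simp [ih]

theorem branchSum_seq {d n : ℕ} [NeZero d] (M : Measurement d n) (p q : Prog) (g : Config d → ℝ)
    (c : Config d) : branchSum M (.seq p q) g c = branchSum M p (branchSum M q g) c := by
  simp only [branchSum, run, sum_map_flatMap]
  rfl

/-- The last iteration acts on the payoff first, so iterating forwards on branches equals iterating
backwards on payoffs. -/
theorem branchSum_loop {d n : ℕ} [NeZero d] (M : Measurement d n) (x : ℕ) (p : Prog)
    (g : Config d → ℝ) (c : Config d) :
    branchSum M (.loop x p) g c =
      (fun g' c' => branchSum M p g' (c'.tick 1))^[c.reg x] g (c.tick 1) := by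
  have key : ∀ (k : ℕ) (l : List (Config d)),
      (((fun l : List (Config d) => l.flatMap fun c' => run M p (c'.tick 1))^[k] l).map g).sum =
        (l.map ((fun g' c' => branchSum M p g' (c'.tick 1))^[k] g)).sum := by
    intro k
    induction k with
    | zero => intro l; rfl
    | succ k ih =>
      intro l
      rw [Function.iterate_succ_apply, ih, Function.iterate_succ_apply', sum_map_flatMap]
      rfl
  rw [branchSum, run, key]
  simp

theorem branchSum_of_run_eq {d n : ℕ} [NeZero d] {M : Measurement d n} {p : Prog} {c c' : Config d}
    (h : run M p c = [c']) (g : Config d → ℝ) : branchSum M p g c = g c' := by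
  simp [branchSum, h]

theorem branchSum_of_run_eq_pair {d n : ℕ} [NeZero d] {M : Measurement d n} {p : Prog}
    {c c₁ c₂ : Config d} (h : run M p c = [c₁, c₂]) (g : Config d → ℝ) :
    branchSum M p g c = g c₁ + g c₂ := by
  simp [branchSum, h]

theorem run_seq_of_eq {d n : ℕ} [NeZero d] {M : Measurement d n} {p q : Prog} {c c' : Config d}
    (h : run M p c = [c']) : run M (.seq p q) c = run M q c' := by
  simp [run, h]

theorem forall_run_seq {d n : ℕ} [NeZero d] {M : Measurement d n} {p q : Prog} {c : Config d}
    {P Q : Config d → Prop} (hp : ∀ c' ∈ run M p c, P c')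
    (hq : ∀ c', P c' → ∀ c'' ∈ run M q c', Q c'') : ∀ c' ∈ run M (.seq p q) c, Q c' := by
  intro c' hc'
  simp only [run, List.mem_flatMap] at hc'
  obtain ⟨a, ha, hac⟩ := hc'
  exact hq a (hp a ha) c' hac

/-- Loop rule for all branches. -/
theorem forall_run_loop {d n : ℕ} [NeZero d] {M : Measurement d n} {x : ℕ} {p : Prog} {c : Config d}
    (I : ℕ → Config d → Prop) (h0 : I 0 (c.tick 1))
    (hstep : ∀ i < c.reg x, ∀ c', I i c' → ∀ c'' ∈ run M p (c'.tick 1), I (i + 1) c'') :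
    ∀ c' ∈ run M (.loop x p) c, I (c.reg x) c' := by
  have key : ∀ k ≤ c.reg x, ∀ c' ∈ (fun l : List (Config d) =>
      l.flatMap fun c' => run M p (c'.tick 1))^[k] [c.tick 1], I k c' := by
    intro k
    induction k with
    | zero => simpa using h0
    | succ k ih =>
      intro hk c'
      rw [Function.iterate_succ_apply', List.mem_flatMap]
      rintro ⟨a, ha, hac⟩
      exact hstep k hk a (ih (by omega) a ha) c' hac
  simpa [run] using key _ le_rfl

/-- Loop rule for programs without measurements. -/
theorem exists_run_loop_eq {d n : ℕ} [NeZero d] {M : Measurement d n} {x : ℕ} {p : Prog}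
    {c : Config d} (I : ℕ → Config d → Prop) (h0 : I 0 (c.tick 1))
    (hstep : ∀ i < c.reg x, ∀ c', I i c' → ∃ c'', run M p (c'.tick 1) = [c''] ∧ I (i + 1) c'') :
    ∃ c', run M (.loop x p) c = [c'] ∧ I (c.reg x) c' := by
  have key : ∀ k ≤ c.reg x, ∃ c', (fun l : List (Config d) =>
      l.flatMap fun c' => run M p (c'.tick 1))^[k] [c.tick 1] = [c'] ∧ I k c' := by
    intro k
    induction k with
    | zero => exact fun _ => ⟨_, rfl, h0⟩
    | succ k ih =>
      intro hk
      obtain ⟨a, ha, hI⟩ := ih (by omega)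
      obtain ⟨b, hb, hI'⟩ := hstep k hk a hI
      exact ⟨b, by rw [Function.iterate_succ_apply', ha]; simp [hb], hI'⟩
  simpa [run] using key _ le_rfl

/-- Loop rule for sums over branches: if `V i` is what an iteration makes of `V (i + 1)`, where `V i`
need only be right on the configurations that satisfy the invariant `I i` and where `Z`
configurations count zero, then the loop makes `V 0` of `V N`. -/
theorem branchSum_loop_eq {d n : ℕ} [NeZero d] {M : Measurement d n} {x : ℕ} {p : Prog}
    {c : Config d} (I : ℕ → Config d → Prop) (Z : Config d → Prop) (V : ℕ → Config d → ℝ)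
    {g : Config d → ℝ} (h0 : I 0 (c.tick 1))
    (hZ : ∀ c, Z c → ∀ c' ∈ run M p (c.tick 1), Z c')
    (hgZ : ∀ c, Z c → g c = 0) (hg : ∀ c', I (c.reg x) c' → g c' = V (c.reg x) c')
    (hstep : ∀ i < c.reg x, ∀ g' : Config d → ℝ, (∀ c, Z c → g' c = 0) →
      (∀ c', I (i + 1) c' → g' c' = V (i + 1) c') →
      ∀ c', I i c' → branchSum M p g' (c'.tick 1) = V i c') :
    branchSum M (.loop x p) g c = V 0 (c.tick 1) := by
  rw [branchSum_loop]
  set W := (fun (g' : Config d → ℝ) (c' : Config d) => branchSum M p g' (c'.tick 1))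
  -- `W^[k] g` is the value with `k` iterations still to come, that is, at time `c.reg x - k`.
  have key : ∀ k ≤ c.reg x, (∀ c, Z c → W^[k] g c = 0) ∧
      ∀ c', I (c.reg x - k) c' → W^[k] g c' = V (c.reg x - k) c' := by
    intro k
    induction k with
    | zero => exact fun _ => ⟨hgZ, hg⟩
    | succ k ih =>
      intro hk
      obtain ⟨ih1, ih2⟩ := ih (by omega)
      have hk' : c.reg x - (k + 1) + 1 = c.reg x - k := by omega
      simp only [Function.iterate_succ_apply']
      refine ⟨fun a ha => List.sum_eq_zero fun r hr => ?_,
        hstep (c.reg x - (k + 1)) (by omega) _ ih1 (by rw [hk']; exact ih2)⟩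
      obtain ⟨b, hb, rfl⟩ := List.mem_map.1 hr
      exact ih1 b (hZ a ha b hb)
  have := (key _ le_rfl).2
  rw [Nat.sub_self] at this
  exact this _ h0

theorem branchSum_eq_zero {d n : ℕ} [NeZero d] {M : Measurement d n} {p : Prog} {c : Config d}
    {g : Config d → ℝ} (h : ∀ c' ∈ run M p c, g c' = 0) : branchSum M p g c = 0 := by
  refine List.sum_eq_zero fun r hr => ?_
  obtain ⟨b, hb, rfl⟩ := List.mem_map.1 hr
  exact h b hb

/-- The program `p` changes register `a` only by subtractions from it. -/
def Prog.NonIncreasing (a : ℕ) : Prog → Prop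
  | .const x _ | .add x _ _ | .measQ _ x | .testI _ _ x | .query x => x ≠ a
  | .sub x y _ => x = a → y = a
  | .seq p q | .ifZero _ p q => p.NonIncreasing a ∧ q.NonIncreasing a
  | .loop _ p => p.NonIncreasing a
  | _ => True

/-- Applied to the flag: subtraction is cut off at `0`, so a cleared flag stays cleared. -/
theorem Prog.NonIncreasing.reg_le {d n : ℕ} [NeZero d] {M : Measurement d n} {a : ℕ} {p : Prog}
    (hp : p.NonIncreasing a) (c : Config d) : ∀ c' ∈ run M p c, c'.reg a ≤ c.reg a := by
  induction p generalizing c with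
  | seq p q ihp ihq => exact forall_run_seq (ihp hp.1 c) fun c' h c'' h' => (ihq hp.2 c' c'' h').trans h
  | ifZero x p q ihp ihq =>
    rw [run]
    split_ifs
    · exact ihp hp.1 _
    · exact ihq hp.2 _
  | loop x p ih =>
    exact forall_run_loop (fun _ c' => c'.reg a ≤ c.reg a) le_rfl
      fun i _ c' h c'' h' => (ih hp _ c'' h').trans h
  | sub x y z =>
    intro c' hc'
    simp only [run, List.mem_singleton] at hc'
    subst hc'
    by_cases hx : x = a
    · obtain rfl := hp hx
      simp [Config.assign, Config.tick, hx]
    · simp [Config.assign, Config.tick, Function.update_of_ne (Ne.symm hx)]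
  | _ =>
    simp only [Prog.NonIncreasing] at hp
    first
      | (simp [run, Config.apply, Config.tick]; done)
      | simp +contextual [run, Config.assign, Config.apply, Config.tick, Function.update_of_ne,
          Ne.symm hp]

/-! ## States that represent operators -/

theorem linExt_eq_linearCombination {d : ℕ} (f : QBasis d → QState d) :
    linExt f = Finsupp.linearCombination ℂ f := by
  funext ψ
  rw [Finsupp.linearCombination_apply]
  rfl

theorem linExt_single {d : ℕ} (f : QBasis d → QState d) (b : QBasis d) (a : ℂ) :
    linExt f (Finsupp.single b a) = a • f b := by
  simp [linExt_eq_linearCombination]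

theorem linExt_sum {d : ℕ} (f : QBasis d → QState d) {ι : Type*} (s : Finset ι)
    (ψ : ι → QState d) : linExt f (∑ i ∈ s, ψ i) = ∑ i ∈ s, linExt f (ψ i) := by
  simp only [linExt_eq_linearCombination, map_sum]

theorem linExt_smul {d : ℕ} (f : QBasis d → QState d) (a : ℂ) (ψ : QState d) :
    linExt f (a • ψ) = a • linExt f ψ := by
  simp only [linExt_eq_linearCombination, map_smul]

/-- The qudits `0, …, n - 1` have the values `x`, the next `n` the values `y`, the others `0`. -/
def pairQudits {d n : ℕ} [NeZero d] (x y : Idx d n) : ℕ → Fin d :=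
  overwrite (overwrite (fun _ => 0) y <| · - n) x

theorem pairQudits_of_lt {d n : ℕ} [NeZero d] (x y : Idx d n) {k : ℕ} (hk : k < n) :
    pairQudits x y k = x ⟨k, hk⟩ := by
  simp [pairQudits, overwrite, hk]

theorem pairQudits_add {d n : ℕ} [NeZero d] (x y : Idx d n) {k : ℕ} (hk : k < n) :
    pairQudits x y (n + k) = y ⟨k, hk⟩ := by
  simp [pairQudits, overwrite, hk]

theorem pairQudits_of_le {d n : ℕ} [NeZero d] (x y : Idx d n) {k : ℕ} (hk : n + n ≤ k) :
    pairQudits x y k = 0 := by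
  simp only [pairQudits, overwrite]
  rw [dif_neg (by omega), dif_neg (by omega)]

/-- A row of qudits that is `0` from `2 n` on. -/
theorem eq_pairQudits {d n : ℕ} [NeZero d] {q : ℕ → Fin d} {x y : Idx d n}
    (h1 : ∀ k (hk : k < n), q k = x ⟨k, hk⟩) (h2 : ∀ k (hk : k < n), q (n + k) = y ⟨k, hk⟩)
    (h3 : ∀ k, n + n ≤ k → q k = 0) : q = pairQudits x y := by
  funext k
  rcases lt_or_ge k n with hk | hk
  · rw [h1 k hk, pairQudits_of_lt]
  · rcases lt_or_ge k (n + n) with hk' | hk'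
    · obtain ⟨j, rfl⟩ := Nat.exists_eq_add_of_le hk
      rw [h2 j (by omega), pairQudits_add]
    · rw [h3 k hk', pairQudits_of_le _ _ hk']

theorem overwrite_pairQudits {d n : ℕ} [NeZero d] (x y z : Idx d n) :
    overwrite (pairQudits x y) z = pairQudits z y := by
  funext k
  simp only [pairQudits, overwrite]
  split_ifs <;> rfl

theorem pairQudits_injective {d n : ℕ} [NeZero d] :
    Function.Injective fun z : Idx d n × Idx d n => pairQudits z.1 z.2 := by
  rintro ⟨x, y⟩ ⟨x', y'⟩ h
  have h' : ∀ k, pairQudits x y k = pairQudits x' y' k := fun k => congrFun h k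
  refine Prod.ext (funext fun k => ?_) (funext fun k => ?_)
  · have := h' k
    rwa [pairQudits_of_lt _ _ k.2, pairQudits_of_lt _ _ k.2] at this
  · have := h' (n + k)
    rwa [pairQudits_add _ _ k.2, pairQudits_add _ _ k.2] at this

/-- The quantum integer `0` has the value `v`, the others are `0`. -/
def intVal (v : ℕ) : ℕ → ℕ := Function.update (fun _ => 0) 0 v

@[simp] theorem intVal_apply_zero (v : ℕ) : intVal v 0 = v := by simp [intVal]

theorem intVal_zero : intVal 0 = fun _ => 0 := by simp [intVal]

theorem update_intVal (v w : ℕ) : Function.update (intVal v) 0 w = intVal w := by simp [intVal]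

/-- The state `∑ x y, A x y |x⟩|y⟩` of the first `2 n` qudits, with the value `v` of the quantum
integer `0`. -/
def opState {d n : ℕ} [NeZero d] (A : Op d n) (v : ℕ) : QState d :=
  ∑ x, ∑ y, Finsupp.single (pairQudits x y, intVal v) (A x y)

theorem opState_smul {d n : ℕ} [NeZero d] (a : ℂ) (A : Op d n) (v : ℕ) :
    opState (a • A) v = a • opState A v := by
  simp [opState, Finset.smul_sum]

theorem opState_add {d n : ℕ} [NeZero d] (A B : Op d n) (v : ℕ) :
    opState (A + B) v = opState A v + opState B v := by
  simp only [opState, Matrix.add_apply, Finsupp.single_add, Finset.sum_add_distrib]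

theorem opState_sum {d n : ℕ} [NeZero d] {ι : Type*} (s : Finset ι) (A : ι → Op d n) (v : ℕ) :
    opState (∑ i ∈ s, A i) v = ∑ i ∈ s, opState (A i) v := by
  classical
  induction s using Finset.induction_on with
  | empty => simp [opState]
  | insert i s hi ih => rw [Finset.sum_insert hi, Finset.sum_insert hi, opState_add, ih]

theorem linExt_opState {d n : ℕ} [NeZero d] (f : QBasis d → QState d) (A : Op d n) (v : ℕ) :
    linExt f (opState A v) = ∑ x, ∑ y, A x y • f (pairQudits x y, intVal v) := by
  simp only [opState, linExt_sum, linExt_single]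

/-- Acting on the first half of a vectorized matrix is multiplication from the left. -/
theorem applyOp_opState {d n : ℕ} [NeZero d] (B A : Op d n) (v : ℕ) :
    applyOp B (opState A v) = opState (B * A) v := by
  rw [applyOp, linExt_opState]
  have : ∀ x y : Idx d n, (fun k : Fin n => pairQudits x y k) = x := fun x y =>
    funext fun k => pairQudits_of_lt _ _ k.2
  simp only [overwrite_pairQudits, this, Finset.smul_sum, Finsupp.smul_single, opState,
    Matrix.mul_apply, smul_eq_mul, Finsupp.single_finsetSum]
  have h : ∀ z : Idx d n, ∀ x y : Idx d n,
      Finsupp.single (pairQudits z y, intVal v) (A x y * B z x) =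
        Finsupp.single (pairQudits z y, intVal v) (B z x * A x y) := fun z x y => by rw [mul_comm]
  simp only [h]
  rw [Finset.sum_congr rfl fun x _ => Finset.sum_comm, Finset.sum_comm]
  exact Finset.sum_congr rfl fun z _ => Finset.sum_comm

theorem fourierEntry_zero_left (m y : ℕ) : fourierEntry m 0 y = (Real.sqrt m : ℂ)⁻¹ := by
  simp [fourierEntry]

theorem fourierEntry_zero_right (m x : ℕ) : fourierEntry m x 0 = (Real.sqrt m : ℂ)⁻¹ := by
  simp [fourierEntry]

theorem fourierInt_opState_zero {d n : ℕ} [NeZero d] (A : Op d n) {m : ℕ} (hm : 0 < m) :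
    fourierInt 0 m (opState A 0) =
      (Real.sqrt m : ℂ)⁻¹ • ∑ y ∈ Finset.range m, opState A y := by
  rw [fourierInt, linExt_opState]
  simp only [intVal_apply_zero, if_pos hm, update_intVal, fourierEntry_zero_left, opState,
    Finset.smul_sum, Finsupp.smul_single, smul_eq_mul]
  simp only [mul_comm]
  rw [Finset.sum_congr rfl fun x _ => Finset.sum_comm, Finset.sum_comm]

/-- Row and column `0` of the Fourier matrix are the constant `1/√m`. Hence the forward transform
also serves for the projection onto the uniform superposition, and no inverse transform is needed.
-/
theorem filter_fourierInt_opState {d n : ℕ} [NeZero d] (A : Op d n) {m v : ℕ} (hv : v < m) :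
    (fourierInt 0 m (opState A v)).filter (fun b => b.2 0 = 0) =
      (Real.sqrt m : ℂ)⁻¹ • opState A 0 := by
  have h : ∀ (x y : Idx d n) (w : ℕ) (a : ℂ),
      (Finsupp.single (pairQudits x y, intVal w) a : QState d).filter (fun b => b.2 0 = 0) =
        if w = 0 then Finsupp.single (pairQudits x y, intVal w) a else 0 := by
    intro x y w a
    split_ifs with hw
    · exact Finsupp.filter_single_of_pos _ (by simpa using hw)
    · exact Finsupp.filter_single_of_neg _ (by simpa using hw)
  rw [fourierInt, linExt_opState]
  simp only [intVal_apply_zero, if_pos hv, update_intVal, Finset.smul_sum, Finsupp.smul_single,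
    smul_eq_mul, Finsupp.filter_sum, h, Finset.sum_ite_eq', Finset.mem_range, opState,
    if_pos (Nat.zero_lt_of_lt hv), fourierEntry_zero_right]
  simp only [mul_comm]

/-- Row and column indices are relabelled alike, which is what makes conjugation by a transposition
two exchanges of qudits. -/
theorem conj_permOp_apply {d n : ℕ} (τ : Equiv.Perm (Fin n)) (A : Op d n) (x y : Idx d n) :
    (permOp d τ * A * (permOp d τ)ᴴ) x y = A (x ∘ τ) (y ∘ τ) := by
  have h : ∀ x z : Idx d n, (x = fun k => z (τ⁻¹ k)) ↔ z = x ∘ τ := by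
    intro x z
    constructor
    · rintro rfl; funext k; simp
    · rintro rfl; funext k; simp
  simp only [Matrix.mul_apply, permOp, Matrix.conjTranspose_apply, h]
  simp

theorem pairQudits_swap_left {d n : ℕ} [NeZero d] (x y : Idx d n) (i j : Fin n) :
    (fun k => pairQudits x y (Equiv.swap (i : ℕ) j k)) = pairQudits (x ∘ Equiv.swap i j) y := by
  refine eq_pairQudits (fun k hk => ?_) (fun k hk => ?_) (fun k hk => ?_)
  · have : Equiv.swap (i : ℕ) j k = (Equiv.swap i j ⟨k, hk⟩ : Fin n) := by
      simp only [Equiv.swap_apply_def, Fin.ext_iff]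
      split_ifs <;> rfl
    simp only [this, Function.comp, pairQudits_of_lt _ _ (Equiv.swap i j ⟨k, hk⟩).2]
  · rw [Equiv.swap_apply_of_ne_of_ne (by omega) (by omega), pairQudits_add]
  · rw [Equiv.swap_apply_of_ne_of_ne (by omega) (by omega), pairQudits_of_le _ _ hk]

theorem pairQudits_swap_right {d n : ℕ} [NeZero d] (x y : Idx d n) (i j : Fin n) :
    (fun k => pairQudits x y (Equiv.swap (n + i : ℕ) (n + j) k)) =
      pairQudits x (y ∘ Equiv.swap i j) := by
  refine eq_pairQudits (fun k hk => ?_) (fun k hk => ?_) (fun k hk => ?_)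
  · rw [Equiv.swap_apply_of_ne_of_ne (by omega) (by omega), pairQudits_of_lt]
  · have : Equiv.swap (n + i : ℕ) (n + j) (n + k) = n + (Equiv.swap i j ⟨k, hk⟩ : Fin n) := by
      simp only [Equiv.swap_apply_def, Fin.ext_iff, Nat.add_left_cancel_iff]
      split_ifs <;> rfl
    simp only [this, Function.comp, pairQudits_add _ _ (Equiv.swap i j ⟨k, hk⟩).2]
  · rw [Equiv.swap_apply_of_ne_of_ne (by omega) (by omega), pairQudits_of_le _ _ hk]

/-- The two conditional exchanges. -/
theorem cswapQudits_opState {d n : ℕ} [NeZero d] (A : Op d n) (v w : ℕ) (i j : Fin n) :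
    cswapQudits 0 w (n + i) (n + j) (cswapQudits 0 w i j (opState A v)) =
      if v = w then opState (permOp d (Equiv.swap i j) * A * (permOp d (Equiv.swap i j))ᴴ) v
      else opState A v := by
  rw [cswapQudits, cswapQudits, linExt_opState]
  by_cases h : v = w
  · simp only [intVal_apply_zero, if_pos h, pairQudits_swap_left, linExt_sum,
      linExt_single, pairQudits_swap_right, Finsupp.smul_single, smul_eq_mul, mul_one,
      opState, conj_permOp_apply]
    have hs : ∀ x : Idx d n, (x ∘ Equiv.swap i j) ∘ Equiv.swap i j = x := fun x => by
      funext k; simp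
    -- Moving the exchange from the basis vectors to the matrix entries is the substitution `x ↦ x ∘
    -- swap`, an involution.
    let e : Equiv.Perm (Idx d n) :=
      ⟨fun x => x ∘ Equiv.swap i j, fun x => x ∘ Equiv.swap i j, hs, hs⟩
    refine Fintype.sum_equiv e _ _ fun x => Fintype.sum_equiv e _ _ fun y => ?_
    simp only [e, Equiv.coe_fn_mk, hs]
  · simp only [intVal_apply_zero, if_neg h, linExt_sum,
      linExt_single, Finsupp.smul_single, smul_eq_mul, mul_one, opState]

/-! ### Norms of represented operators and resetting of qudits -/

theorem normSq_opState {d n : ℕ} [NeZero d] (A : Op d n) (v : ℕ) :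
    (opState A v).normSq = frobSq A := by
  let g : Idx d n × Idx d n → QBasis d := fun z => (pairQudits z.1 z.2, intVal v)
  have hg : Function.Injective g := fun z z' h => pairQudits_injective (congrArg Prod.fst h)
  have h : opState A v =
      Finsupp.mapDomain g (Finsupp.equivFunOnFinite.symm fun z => A z.1 z.2) := by
    rw [Finsupp.mapDomain, Finsupp.sum_fintype _ _ (by simp), Fintype.sum_prod_type]
    rfl
  rw [h, QState.normSq, Finsupp.sum_mapDomain_index_inj hg, Finsupp.sum_fintype _ _ (by simp),
    Fintype.sum_prod_type]
  rfl

theorem normSq_eq_sum_support {d : ℕ} (ψ : QState d) : ψ.normSq = ∑ b ∈ ψ.support, ‖ψ b‖ ^ 2 := rfl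

theorem setQudit_eq_mapDomain {d : ℕ} (j : ℕ) (z : Fin d) (ψ : QState d) :
    setQudit j z ψ = ψ.mapDomain fun b => (Function.update b.1 j z, b.2) := by
  simp [setQudit, linExt, Finsupp.mapDomain]

/-- After the projection all basis states agree at `j`, so overwriting that value merges none of
them. -/
theorem normSq_setQudit_projQudit {d : ℕ} (j : ℕ) (y z : Fin d) (ψ : QState d) :
    (setQudit j z (projQudit j y ψ)).normSq = (projQudit j y ψ).normSq := by
  classical
  have hinj : Set.InjOn (fun b : QBasis d => (Function.update b.1 j z, b.2))
      (projQudit j y ψ).support := by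
    rintro b hb b' hb' h
    simp only [projQudit, Finsupp.support_filter, Finset.coe_filter, Set.mem_ofPred_eq] at hb hb'
    simp only [Prod.mk.injEq] at h
    refine Prod.ext (funext fun k => ?_) h.2
    by_cases hk : k = j
    · rw [hk, hb.2, hb'.2]
    · simpa [hk] using congrFun h.1 k
  rw [setQudit_eq_mapDomain, normSq_eq_sum_support, normSq_eq_sum_support,
    Finsupp.mapDomain_support_of_injOn _ hinj, Finset.sum_image hinj]
  refine Finset.sum_congr rfl fun b hb => ?_
  rw [Finsupp.mapDomain_apply' _ _ (Set.Subset.refl _) hinj hb]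

/-- Resetting a qudit keeps the total weight. -/
theorem sum_normSq_setQudit_projQudit {d : ℕ} (j : ℕ) (z : Fin d) (ψ : QState d) :
    ∑ y, (setQudit j z (projQudit j y ψ)).normSq = ψ.normSq := by
  simp only [normSq_setQudit_projQudit]
  simp only [normSq_eq_sum_support, projQudit, Finsupp.support_filter]
  rw [← Finset.sum_fiberwise ψ.support (fun b => b.1 j)]
  refine Finset.sum_congr rfl fun y _ => Finset.sum_congr rfl fun b hb => ?_
  rw [Finsupp.filter_apply_pos (fun b : QBasis d => b.1 j = y) _ (Finset.mem_filter.1 hb).2]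

theorem mem_support_setQudit {d : ℕ} {j : ℕ} {z : Fin d} {ψ : QState d} {b : QBasis d}
    (hb : b ∈ (setQudit j z ψ).support) :
    ∃ b' ∈ ψ.support, b = (Function.update b'.1 j z, b'.2) := by
  classical
  rw [setQudit_eq_mapDomain] at hb
  obtain ⟨b', hb', h⟩ := Finset.mem_image.1 (Finsupp.mapDomain_support hb)
  exact ⟨b', hb', h.symm⟩

/-! ### Maximally entangled pairs -/

/-- The first `i` pairs of qudits are maximally entangled, the others are `0`. -/
def partialDiag (d n i : ℕ) [NeZero d] : Finset (Idx d n) := {x | ∀ k : Fin n, i ≤ k → x k = 0}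

/-- The Fourier transform sends `|0⟩` to the uniform superposition of the `|y⟩`, and the sum gate
copies `y` onto the partner qudit, which is still `0`. -/
theorem sumQudits_fourierQudit_diag {d n i : ℕ} [NeZero d] (hi : i < n) :
    sumQudits i (n + i) (fourierQudit i
      (∑ x ∈ partialDiag d n i, Finsupp.single (pairQudits x x, fun _ => 0) 1)) =
      (Real.sqrt d : ℂ)⁻¹ •
        ∑ x ∈ partialDiag d n (i + 1), Finsupp.single (pairQudits x x, fun _ => 0) 1 := by
  have hstep : ∀ x ∈ partialDiag d n i, sumQudits i (n + i) (fourierQudit i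
      (Finsupp.single (pairQudits x x, fun _ => 0) 1)) = ∑ y, (Real.sqrt d : ℂ)⁻¹ •
        Finsupp.single (pairQudits (Function.update x ⟨i, hi⟩ y)
          (Function.update x ⟨i, hi⟩ y), fun _ => 0) 1 := by
    intro x hx
    have hxi : x ⟨i, hi⟩ = 0 := (Finset.mem_filter.1 hx).2 _ le_rfl
    have hpair : ∀ y, Function.update (Function.update (pairQudits x x) i y) (n + i) y =
        pairQudits (Function.update x ⟨i, hi⟩ y) (Function.update x ⟨i, hi⟩ y) := by
      intro y
      refine eq_pairQudits (fun k hk => ?_) (fun k hk => ?_) (fun k hk => ?_)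
      · rw [Function.update_of_ne (by omega)]
        simp only [Function.update_apply, Fin.mk.injEq, pairQudits_of_lt x x hk]
      · have : n + k ≠ i := by omega
        simp only [Function.update_apply, Fin.mk.injEq, Nat.add_left_cancel_iff, if_neg this,
          pairQudits_add x x hk]
      · rw [Function.update_of_ne (by omega), Function.update_of_ne (by omega),
          pairQudits_of_le _ _ hk]
    have hne : i ≠ n + i := by omega
    simp only [fourierQudit, sumQudits, linExt_single, one_smul, linExt_sum, if_neg hne,
      pairQudits_of_lt x x hi, hxi, Function.update_self, Function.update_of_ne hne.symm,
      pairQudits_add x x hi, zero_add, hpair, Fin.val_zero, fourierEntry_zero_left]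
  rw [fourierQudit, linExt_sum, sumQudits, linExt_sum]
  refine (Finset.sum_congr rfl hstep).trans ?_
  rw [Finset.smul_sum, ← Finset.sum_product']
  refine Finset.sum_nbij' (fun p => Function.update p.1 ⟨i, hi⟩ p.2)
    (fun x => (Function.update x ⟨i, hi⟩ 0, x ⟨i, hi⟩)) ?_ ?_ ?_ ?_ ?_
  · rintro ⟨x, y⟩ hp
    have hx := (Finset.mem_filter.1 (Finset.mem_product.1 hp).1).2
    refine Finset.mem_filter.2 ⟨Finset.mem_univ _, fun k hk => ?_⟩
    rw [Function.update_of_ne (by rintro rfl; simp at hk)]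
    exact hx k (by omega)
  · intro x hx
    replace hx := (Finset.mem_filter.1 hx).2
    refine Finset.mem_product.2 ⟨Finset.mem_filter.2 ⟨Finset.mem_univ _, fun k hk => ?_⟩,
      Finset.mem_univ _⟩
    by_cases h : k = ⟨i, hi⟩
    · simp [h]
    · dsimp only
      rw [Function.update_of_ne h]
      refine hx k ?_
      have : (k : ℕ) ≠ i := fun h' => h (Fin.ext h')
      omega
  · rintro ⟨x, y⟩ hp
    have hx := (Finset.mem_filter.1 (Finset.mem_product.1 hp).1).2 ⟨i, hi⟩ le_rfl
    simp [← hx]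
  · intro x _
    simp
  · intro p _
    rfl

/-! ### The average over the symmetric group as a product of averages over transpositions -/

/-- The average of `A` over the conjugations with the transpositions `(v m)`, `v ≤ m`. -/
def swapAverage {d n : ℕ} (m : Fin n) (A : Op d n) : Op d n :=
  ((m + 1 : ℕ) : ℂ)⁻¹ • ∑ v ∈ Finset.Iic m,
    permOp d (Equiv.swap v m) * A * (permOp d (Equiv.swap v m))ᴴ

/-- `swapAverage` for `0, …, i - 1` in succession. -/
def swapAverages {d n : ℕ} (A : Op d n) : ℕ → Op d n
  | 0 => A
  | i + 1 => if h : i < n then swapAverage ⟨i, h⟩ (swapAverages A i) else swapAverages A i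

/-- The permutations that fix all `k ≥ i`. -/
def permBelow (n i : ℕ) : Finset (Equiv.Perm (Fin n)) := {τ | ∀ k : Fin n, i ≤ k → τ k = k}

/-- Coset decomposition: `τ` determines `v = τ m`, and then `(v m) τ` fixes `m`. -/
theorem sum_swap_mul_permBelow {n : ℕ} {α : Type*} [AddCommMonoid α] (m : Fin n)
    (f : Equiv.Perm (Fin n) → α) :
    ∑ v ∈ Finset.Iic m, ∑ σ ∈ permBelow n m, f (Equiv.swap v m * σ) =
      ∑ τ ∈ permBelow n (m + 1), f τ := by
  -- If `τ m > m`, then `τ` fixes `τ m`, against injectivity.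
  have hmaps : ∀ τ ∈ permBelow n (m + 1), τ m ∈ Finset.Iic m := by
    intro τ hτ
    rw [Finset.mem_Iic]
    by_contra! h
    have := (Finset.mem_filter.1 hτ).2 (τ m) h
    exact h.ne' (τ.injective this)
  rw [← Finset.sum_fiberwise_of_maps_to hmaps]
  refine Finset.sum_congr rfl fun v hv => ?_
  rw [Finset.mem_Iic] at hv
  refine Finset.sum_nbij' (fun σ => Equiv.swap v m * σ) (fun τ => Equiv.swap v m * τ) ?_ ?_ ?_ ?_ ?_
  · intro σ hσ
    replace hσ := (Finset.mem_filter.1 hσ).2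
    refine Finset.mem_filter.2 ⟨Finset.mem_filter.2 ⟨Finset.mem_univ _, fun k hk => ?_⟩, ?_⟩
    · have hk' : m < k := hk
      rw [Equiv.Perm.mul_apply, hσ k hk'.le,
        Equiv.swap_apply_of_ne_of_ne (hv.trans_lt hk').ne' hk'.ne']
    · rw [Equiv.Perm.mul_apply, hσ m le_rfl, Equiv.swap_apply_right]
  · intro τ hτ
    obtain ⟨hτ, hτm⟩ := Finset.mem_filter.1 hτ
    replace hτ := (Finset.mem_filter.1 hτ).2
    refine Finset.mem_filter.2 ⟨Finset.mem_univ _, fun k hk => ?_⟩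
    rw [Equiv.Perm.mul_apply]
    rcases (show m ≤ k from hk).eq_or_lt with rfl | hk'
    · rw [hτm, Equiv.swap_apply_left]
    · rw [hτ k hk', Equiv.swap_apply_of_ne_of_ne (hv.trans_lt hk').ne' hk'.ne']
  · intro σ _
    simp
  · intro τ _
    simp
  · intro σ _
    rfl

theorem swapAverages_eq {d n : ℕ} (A : Op d n) {i : ℕ} (hi : i ≤ n) :
    swapAverages A i = ((i.factorial : ℂ)⁻¹) •
      ∑ τ ∈ permBelow n i, permOp d τ * A * (permOp d τ)ᴴ := by
  induction i with
  | zero =>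
    have h1 : permBelow n 0 = {1} := by
      ext τ
      simp [permBelow, Equiv.ext_iff]
    have h2 : permOp d (1 : Equiv.Perm (Fin n)) = 1 := by
      ext x y
      simp [permOp, Matrix.one_apply]
    simp [swapAverages, h1, h2]
  | succ i ih =>
    rw [swapAverages, dif_pos (Nat.lt_of_succ_le hi), ih (by omega), swapAverage,
      ← sum_swap_mul_permBelow (⟨i, hi⟩ : Fin n) fun τ => permOp d τ * A * (permOp d τ)ᴴ]
    simp only [Matrix.mul_smul, Matrix.smul_mul, Finset.mul_sum, Finset.sum_mul, ← Finset.smul_sum,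
      smul_smul, ← permOp_mul, Matrix.conjTranspose_mul, Matrix.mul_assoc]
    congr 1
    rw [Nat.factorial_succ, Nat.cast_mul, mul_inv]

theorem swapAverages_eq_permInvComponent {d n : ℕ} (A : Op d n) :
    swapAverages A n = permInvComponent A := by
  rw [swapAverages_eq A le_rfl, permInvComponent]
  congr 2
  ext τ
  simp only [permBelow, Finset.mem_filter, Finset.mem_univ, true_and, iff_true]
  intro k hk
  omega

/-! ## The tester

Registers: `0` holds `n`; `3` the number of rounds; `4` the flag that no test has failed yet; `5` the
constant `1`; `6` the constant `0`; `7`, `8` and `10`, …, `13` addresses of qudits; `9` the dimension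
of a Fourier transform; `14`, `15` outcomes of measurements. -/

/-- Put the qudits `j`, `n + j` in a maximally entangled state, for all `j < n`. -/
def prepareProg : Prog :=
  .seq (.const 7 0) <| .seq (.add 8 0 6) <| .loop 0 <|
    .seq (.fourierQ 7) <| .seq (.sumQ 7 8) <| .seq (.add 7 7 5) (.add 8 8 5)

/-- Exchange the qudits `v`, `m` and the qudits `n + v`, `n + m`, where `v` is the value of the
quantum integer `0`. -/
def selectSwapProg : Prog :=
  .seq (.const 10 0) <| .seq (.add 11 0 6) <| .loop 9 <|
    .seq (.cswapQ 6 10 10 12) <| .seq (.cswapQ 6 10 11 13) <| .seq (.add 10 10 5) (.add 11 11 5)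

/-- Average over the transpositions of `m` with all `v ≤ m`, and clear the flag on failure. -/
def averageProg : Prog :=
  .seq (.add 9 9 5) <| .seq (.fourierI 6 9) <| .seq selectSwapProg <| .seq (.fourierI 6 9) <|
    -- Register `15` becomes `1` exactly on failure. On success the quantum integer is back at `0`,
    -- ready for the next averaging step.
    .seq (.testI 6 6 15) <| .seq (.sub 15 5 15) <| .seq (.sub 4 4 15) <|
    .seq (.add 12 12 5) (.add 13 13 5)

/-- Before the step with index `m`, registers `9` and `12` hold `m`, and register `13` holds `n +
m`. -/
def symmetrizeProg : Prog :=
  .seq (.const 9 0) <| .seq (.const 12 0) <| .seq (.add 13 0 6) <| .loop 0 averageProg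

/-- Register `7` is not set back between the two passes of `resetProg`, so they clear `2 n` qudits.
-/
def resetLoop : Prog := .loop 0 <| .seq (.resetQ 7) (.add 7 7 5)

def resetProg : Prog := .seq (.const 7 0) <| .seq resetLoop resetLoop

def roundProg : Prog :=
  .seq prepareProg <| .seq (.query 14) <| .seq symmetrizeProg resetProg

/-- With addition as the only growing operation, `⌈1/ε⌉` is squared by repeated addition. The final
subtraction of `0` copies the flag to the output register. -/
def testerProg : Prog :=
  .seq (.loop 2 (.add 3 3 2)) <| .seq (.add 3 3 3) <| .seq (.const 4 1) <| .seq (.const 5 1) <|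
    .seq (.loop 3 roundProg) (.sub 0 4 6)

section Config
variable {d : ℕ} (c : Config d)

@[simp] theorem Config.tick_reg (t : ℕ) : (c.tick t).reg = c.reg := rfl
@[simp] theorem Config.tick_state (t : ℕ) : (c.tick t).state = c.state := rfl
@[simp] theorem Config.tick_time (t : ℕ) : (c.tick t).time = c.time + t := rfl
@[simp] theorem Config.tick_queries (t : ℕ) : (c.tick t).queries = c.queries := rfl
@[simp] theorem Config.assign_reg (x v y : ℕ) :
    (c.assign x v).reg y = if y = x then v else c.reg y := by
  simp [Config.assign, Function.update_apply]
@[simp] theorem Config.assign_state (x v : ℕ) : (c.assign x v).state = c.state := rfl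
@[simp] theorem Config.assign_time (x v : ℕ) : (c.assign x v).time = c.time + 1 := rfl
@[simp] theorem Config.assign_queries (x v : ℕ) : (c.assign x v).queries = c.queries := rfl
@[simp] theorem Config.apply_reg (t : ℕ) (f : QState d → QState d) : (c.apply t f).reg = c.reg := rfl
@[simp] theorem Config.apply_state (t : ℕ) (f : QState d → QState d) :
    (c.apply t f).state = f c.state := rfl
@[simp] theorem Config.apply_time (t : ℕ) (f : QState d → QState d) :
    (c.apply t f).time = c.time + t := rfl
@[simp] theorem Config.apply_queries (t : ℕ) (f : QState d → QState d) :
    (c.apply t f).queries = c.queries := rfl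

end Config

/-- The registers that the rounds rely on have their values. -/
structure Ready {d : ℕ} (n : ℕ) (c : Config d) : Prop where
  reg_zero : c.reg 0 = n
  reg_five : c.reg 5 = 1
  reg_six : c.reg 6 = 0

/-- The basis state of the quantum memory in which everything is `0`. -/
abbrev zeroBasis (d : ℕ) [NeZero d] : QBasis d := (fun _ => 0, fun _ => 0)

/-- The claim on the state is conditional, so that the counts of time and queries also cover failed
branches, whose memory need not be clear. -/
theorem exists_run_prepareProg {d n : ℕ} [NeZero d] (M : Measurement d n) {c : Config d}
    (hc : Ready n c) :
    ∃ c', run M prepareProg c = [c'] ∧ Ready n c' ∧ c'.reg 4 = c.reg 4 ∧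
      c'.time = c.time + 3 + 5 * n ∧ c'.queries = c.queries ∧
      ∀ a, c.state = Finsupp.single (zeroBasis d) a →
        c'.state = opState ((a * (Real.sqrt d : ℂ)⁻¹ ^ n) • (1 : Op d n)) 0 := by
  obtain ⟨h0, h5, h6⟩ := hc
  rw [prepareProg, run_seq_of_eq (c' := c.assign 7 0) rfl,
    run_seq_of_eq (c' := (c.assign 7 0).assign 8 (c.reg 0 + c.reg 6)) rfl]
  obtain ⟨c', hrun, hready, h4, -, -, ht, hq, hs⟩ := exists_run_loop_eq (M := M)
    (x := 0) (c := (c.assign 7 0).assign 8 (c.reg 0 + c.reg 6))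
    (p := .seq (.fourierQ 7) <| .seq (.sumQ 7 8) <| .seq (.add 7 7 5) (.add 8 8 5))
    (fun i c' => Ready n c' ∧ c'.reg 4 = c.reg 4 ∧ c'.reg 7 = i ∧ c'.reg 8 = n + i ∧
      c'.time = c.time + 3 + 5 * i ∧ c'.queries = c.queries ∧
      ∀ a, c.state = Finsupp.single (zeroBasis d) a → c'.state = (a * (Real.sqrt d : ℂ)⁻¹ ^ i) •
        ∑ x ∈ partialDiag d n i, Finsupp.single (pairQudits x x, fun _ => 0) 1)
    (by
      refine ⟨⟨by simp [h0], by simp [h5], by simp [h6]⟩, by simp, by simp, by simp [h0, h6],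
        by simp, by simp, fun a ha => ?_⟩
      have hzero : partialDiag d n 0 = {fun _ => 0} := by
        ext x
        simp [partialDiag, funext_iff]
      have hpair : (fun _ => 0 : ℕ → Fin d) = pairQudits (n := n) (fun _ => 0) (fun _ => 0) :=
        eq_pairQudits (fun _ _ => rfl) (fun _ _ => rfl) (fun _ _ => rfl)
      simp [ha, hzero, ← hpair])
    (by
      rintro i hi c' ⟨⟨k0, k5, k6⟩, k4, k7, k8, kt, kq, ks⟩
      refine ⟨(((((c'.tick 1).apply 1 (fourierQudit (c'.reg 7))).apply 1
        (sumQudits (c'.reg 7) (c'.reg 8))).assign 7 (c'.reg 7 + c'.reg 5)).assign 8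
          (c'.reg 8 + c'.reg 5)), rfl, ⟨by simp [k0], by simp [k5], by simp [k6]⟩, by simp [k4],
        by simp [k7, k5], by simp [k8, k5, add_assoc], by simp [kt]; ring, by simp [kq],
        fun a ha => ?_⟩
      have hin : i < n := by simpa [h0] using hi
      simp only [Config.assign_state, Config.apply_state, Config.tick_state, ks a ha, k7, k8]
      have hlin : ∀ (b : ℂ) (ψ : QState d), sumQudits i (n + i) (fourierQudit i (b • ψ)) =
          b • sumQudits i (n + i) (fourierQudit i ψ) := fun b ψ => by
        rw [fourierQudit, linExt_smul, sumQudits, linExt_smul]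
      rw [hlin, sumQudits_fourierQudit_diag hin, smul_smul, pow_succ, mul_assoc])
  have hn : ((c.assign 7 0).assign 8 (c.reg 0 + c.reg 6)).reg 0 = n := by simp [h0]
  rw [hn] at ht hs
  refine ⟨c', hrun, hready, h4, ht, hq, fun a ha => ?_⟩
  have huniv : partialDiag d n n = Finset.univ := by
    ext x
    simp only [partialDiag, Finset.mem_filter, Finset.mem_univ, true_and, iff_true]
    intro k hk
    omega
  rw [hs a ha, huniv, opState_smul]
  congr 1
  refine Finset.sum_congr rfl fun x _ => ?_
  rw [Finset.sum_eq_single x (fun y _ hy => by rw [Matrix.one_apply_ne hy.symm]; simp)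
    (by simp), Matrix.one_apply_eq, intVal_zero]

/-- A classical loop runs through `0, …, m`; the component with control value `v` is acted on only
in iteration `v`. -/
theorem exists_run_selectSwapProg {d n : ℕ} [NeZero d] (M : Measurement d n) {c : Config d}
    (hc : Ready n c) (m : Fin n) (h9 : c.reg 9 = m + 1) (h12 : c.reg 12 = m)
    (h13 : c.reg 13 = n + m) :
    ∃ c', run M selectSwapProg c = [c'] ∧ Ready n c' ∧ c'.reg 4 = c.reg 4 ∧ c'.reg 9 = m + 1 ∧
      c'.reg 12 = m ∧ c'.reg 13 = n + m ∧ c'.time = c.time + 8 + 5 * m ∧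
      c'.queries = c.queries ∧
      ∀ (s : ℂ) (A : Op d n), c.state = s • ∑ v ∈ Finset.Iic m, opState A v →
        c'.state = s • ∑ v ∈ Finset.Iic m,
          opState (permOp d (Equiv.swap v m) * A * (permOp d (Equiv.swap v m))ᴴ) v := by
  obtain ⟨h0, h5, h6⟩ := hc
  rw [selectSwapProg, run_seq_of_eq (c' := c.assign 10 0) rfl,
    run_seq_of_eq (c' := (c.assign 10 0).assign 11 (c.reg 0 + c.reg 6)) rfl]
  obtain ⟨c', hrun, hready, h4, k9, k12, k13, -, -, ht, hq, hs⟩ := exists_run_loop_eq (M := M)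
    (x := 9) (c := (c.assign 10 0).assign 11 (c.reg 0 + c.reg 6))
    (p := .seq (.cswapQ 6 10 10 12) <| .seq (.cswapQ 6 10 11 13) <|
      .seq (.add 10 10 5) (.add 11 11 5))
    (fun i c' => Ready n c' ∧ c'.reg 4 = c.reg 4 ∧ c'.reg 9 = m + 1 ∧
      c'.reg 12 = m ∧ c'.reg 13 = n + m ∧ c'.reg 10 = i ∧ c'.reg 11 = n + i ∧
      c'.time = c.time + 3 + 5 * i ∧ c'.queries = c.queries ∧
      ∀ (s : ℂ) (A : Op d n), c.state = s • ∑ v ∈ Finset.Iic m, opState A v →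
        c'.state = s • ∑ v ∈ Finset.Iic m, if (v : ℕ) < i then
          opState (permOp d (Equiv.swap v m) * A * (permOp d (Equiv.swap v m))ᴴ) v
          else opState A v)
    (by
      exact ⟨⟨by simp [h0], by simp [h5], by simp [h6]⟩, by simp, by simp [h9], by simp [h12],
        by simp [h13], by simp, by simp [h0, h6], by simp, by simp, fun s A hA => by simp [hA]⟩)
    (by
      rintro i hi c' ⟨⟨k0, k5, k6⟩, k4, k9, k12, k13, k10, k11, kt, kq, ks⟩
      refine ⟨(((((c'.tick 1).apply 1
        (cswapQudits (c'.reg 6) (c'.reg 10) (c'.reg 10) (c'.reg 12))).apply 1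
        (cswapQudits (c'.reg 6) (c'.reg 10) (c'.reg 11) (c'.reg 13))).assign 10
          (c'.reg 10 + c'.reg 5)).assign 11 (c'.reg 11 + c'.reg 5)), rfl,
        ⟨by simp [k0], by simp [k5], by simp [k6]⟩, by simp [k4], by simp [k9], by simp [k12],
        by simp [k13], by simp [k10, k5], by simp [k11, k5, add_assoc], by simp [kt]; ring,
        by simp [kq], fun s A hA => ?_⟩
      have him : i < m + 1 := by simpa [h9] using hi
      have hin : i < n := by omega
      simp only [Config.assign_state, Config.apply_state, Config.tick_state, ks s A hA, k6, k10,
        k11, k12, k13]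
      have hlin : ∀ ψ : Fin n → QState d, cswapQudits 0 i (n + i) (n + m)
          (cswapQudits 0 i i m (s • ∑ v ∈ Finset.Iic m, ψ v)) = s • ∑ v ∈ Finset.Iic m,
            cswapQudits 0 i (n + i) (n + m) (cswapQudits 0 i i m (ψ v)) := fun ψ => by
        rw [cswapQudits, cswapQudits, linExt_smul, linExt_smul, linExt_sum, linExt_sum]
      have hstep : ∀ (B : Op d n) (v : ℕ),
          cswapQudits 0 i (n + i) (n + m) (cswapQudits 0 i i m (opState B v)) = _ :=
        fun B v => cswapQudits_opState B v i ⟨i, hin⟩ m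
      rw [hlin]
      congr 1
      refine Finset.sum_congr rfl fun v _ => ?_
      split_ifs with h1 h2 h2
      · rw [hstep, if_neg h1.ne]
      · omega
      · have hv : (v : ℕ) = i := by omega
        obtain rfl : v = ⟨i, hin⟩ := Fin.ext hv
        rw [hstep, if_pos rfl]
      · rw [hstep, if_neg (by omega)])
  have hn : ((c.assign 10 0).assign 11 (c.reg 0 + c.reg 6)).reg 9 = m + 1 := by simp [h9]
  rw [hn] at ht hs
  refine ⟨c', hrun, hready, h4, k9, k12, k13, by rw [ht]; ring, hq, fun s A hA => ?_⟩
  rw [hs s A hA]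
  congr 1
  refine Finset.sum_congr rfl fun v hv => if_pos ?_
  exact Nat.lt_succ_of_le (Fin.le_def.1 (Finset.mem_Iic.1 hv))

theorem sum_range_opState {d n : ℕ} [NeZero d] (A : Op d n) (m : Fin n) :
    ∑ y ∈ Finset.range (m + 1), opState A y = ∑ v ∈ Finset.Iic m, opState A v := by
  have : Finset.range (m + 1) = (Finset.Iic m).map Fin.valEmbedding := by
    rw [Fin.map_valEmbedding_Iic]
    ext; simp
  rw [this, Finset.sum_map]
  rfl

/-- What the branches of the averaging step have in common. -/
structure AveragePost {d : ℕ} (n i : ℕ) (c c' : Config d) : Prop where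
  ready : Ready n c'
  reg_nine : c'.reg 9 = i + 1
  reg_twelve : c'.reg 12 = i + 1
  reg_thirteen : c'.reg 13 = n + (i + 1)
  time : c'.time = c.time + (7 * i + 18)
  queries : c'.queries = c.queries

theorem exists_run_averageProg {d n : ℕ} [NeZero d] (M : Measurement d n) {c : Config d}
    (hc : Ready n c) (m : Fin n) (h9 : c.reg 9 = m) (h12 : c.reg 12 = m) (h13 : c.reg 13 = n + m) :
    ∃ c₁ c₂, run M averageProg c = [c₁, c₂] ∧ AveragePost n m c c₁ ∧ AveragePost n m c c₂ ∧
      c₁.reg 4 = c.reg 4 ∧ c₂.reg 4 = c.reg 4 - 1 ∧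
      ∀ A : Op d n, c.state = opState A 0 → c₁.state = opState (swapAverage m A) 0 := by
  obtain ⟨h0, h5, h6⟩ := hc
  set c₀ := (c.assign 9 (c.reg 9 + c.reg 5)).apply (m + 2) (fourierInt 0 (m + 1)) with hc₀
  have hrun₀ : ∀ q, run M (.seq (.add 9 9 5) (.seq (.fourierI 6 9) q)) c = run M q c₀ := by
    intro q
    rw [run_seq_of_eq (c' := c.assign 9 (c.reg 9 + c.reg 5)) rfl]
    refine run_seq_of_eq ?_
    simp [run, hc₀, h6, h9, h5]
  obtain ⟨c', hrun, ⟨k0, k5, k6⟩, k4, k9, k12, k13, kt, kq, ks⟩ := exists_run_selectSwapProg M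
    (c := c₀) ⟨by simp [hc₀, h0], by simp [hc₀, h5], by simp [hc₀, h6]⟩ m
    (by simp [hc₀, h9, h5]) (by simp [hc₀, h12]) (by simp [hc₀, h13])
  rw [averageProg, hrun₀, run_seq_of_eq hrun]
  refine ⟨_, _, rfl, ⟨⟨?_, ?_, ?_⟩, ?_, ?_, ?_, ?_, ?_⟩, ⟨⟨?_, ?_, ?_⟩, ?_, ?_, ?_, ?_, ?_⟩, ?_, ?_,
    fun A hA => ?_⟩
  -- The state of the success branch: each of the two Fourier transforms contributes `1/√(m + 1)`,
  -- together the weight `1/(m + 1)` of `swapAverage`. The other goals are bookkeeping.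
  case refine_19 =>
    have hc₀s : c₀.state = (Real.sqrt (m + 1 : ℕ) : ℂ)⁻¹ • ∑ v ∈ Finset.Iic m, opState A v := by
      rw [← sum_range_opState, ← fourierInt_opState_zero A (Nat.succ_pos _), ← hA]
      rfl
    simp only [Config.assign_state, Config.apply_state, Config.apply_reg, ks _ _ hc₀s, k6, k9]
    have hlin : ∀ (s : ℂ) (ψ : Fin n → QState d),
        (fourierInt 0 (m + 1) (s • ∑ v ∈ Finset.Iic m, ψ v)).filter (fun b => b.2 0 = 0) =
        s • ∑ v ∈ Finset.Iic m, (fourierInt 0 (m + 1) (ψ v)).filter (fun b => b.2 0 = 0) := by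
      intro s ψ
      rw [fourierInt, linExt_smul, linExt_sum, Finsupp.filter_smul, Finsupp.filter_sum]
    rw [hlin, Finset.sum_congr rfl fun v hv => filter_fourierInt_opState _
      (Nat.lt_add_one_of_le (Fin.le_def.1 (Finset.mem_Iic.1 hv))), ← Finset.smul_sum, smul_smul, swapAverage,
      opState_smul, opState_sum]
    congr 1
    rw [← mul_inv, ← Complex.ofReal_mul, Real.mul_self_sqrt (Nat.cast_nonneg _)]
    simp
  all_goals simp [k0, k5, k6, k4, k9, k12, k13, kt, kq, hc₀]
  all_goals omega

theorem nonIncreasing_averageProg : averageProg.NonIncreasing 4 := by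
  simp [averageProg, selectSwapProg, Prog.NonIncreasing]

/-- Failed branches are included. Step `i` takes `7 i + 18` units and one for the iteration, at most
`7 n + 19`. -/
theorem forall_run_symmetrizeProg {d n : ℕ} [NeZero d] (M : Measurement d n) {c : Config d}
    (hc : Ready n c) : ∀ c' ∈ run M symmetrizeProg c, Ready n c' ∧
      c'.time ≤ c.time + 4 + n * (7 * n + 19) ∧ c'.queries = c.queries := by
  obtain ⟨h0, h5, h6⟩ := hc
  rw [symmetrizeProg, run_seq_of_eq (c' := c.assign 9 0) rfl,
    run_seq_of_eq (c' := (c.assign 9 0).assign 12 0) rfl,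
    run_seq_of_eq (c' := ((c.assign 9 0).assign 12 0).assign 13 (c.reg 0 + c.reg 6)) rfl]
  have hn : (((c.assign 9 0).assign 12 0).assign 13 (c.reg 0 + c.reg 6)).reg 0 = n := by simp [h0]
  intro c' hc'
  have := forall_run_loop (fun i c' => Ready n c' ∧ c'.reg 9 = i ∧ c'.reg 12 = i ∧
    c'.reg 13 = n + i ∧ c'.time ≤ c.time + 4 + i * (7 * n + 19) ∧ c'.queries = c.queries)
    ?_ ?_ c' hc'
  · rw [hn] at this
    exact ⟨this.1, this.2.2.2.2⟩
  · exact ⟨⟨by simp [h0], by simp [h5], by simp [h6]⟩, by simp, by simp, by simp [h0, h6], by simp,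
      by simp⟩
  · rw [hn]
    rintro i hi c' ⟨⟨k0, k5, k6⟩, k9, k12, k13, kt, kq⟩
    obtain ⟨c₁, c₂, hrun, h₁, h₂, -⟩ := exists_run_averageProg M (c := c'.tick 1) ⟨k0, k5, k6⟩
      ⟨i, hi⟩ k9 k12 k13
    have key : ∀ c'', AveragePost n i (c'.tick 1) c'' → Ready n c'' ∧ c''.reg 9 = i + 1 ∧
        c''.reg 12 = i + 1 ∧ c''.reg 13 = n + (i + 1) ∧
        c''.time ≤ c.time + 4 + (i + 1) * (7 * n + 19) ∧ c''.queries = c.queries := by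
      rintro c'' ⟨h1, h2, h3, h4, h5, h6⟩
      refine ⟨h1, h2, h3, h4, ?_, by simpa [kq] using h6⟩
      simp only [Config.tick_time] at h5
      rw [add_one_mul]
      omega
    rw [hrun]
    simpa using ⟨key _ h₁, key _ h₂⟩

/-- The branch in which all averaging steps succeed decides. -/
theorem branchSum_symmetrizeProg {d n : ℕ} [NeZero d] (M : Measurement d n) {c : Config d}
    (hc : Ready n c) (h4 : c.reg 4 = 1) {A : Op d n} (hA : c.state = opState A 0)
    {g : Config d → ℝ} {r : ℝ} (hg0 : ∀ c, c.reg 4 = 0 → g c = 0)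
    (hg : ∀ c', Ready n c' → c'.reg 4 = 1 → c'.state = opState (permInvComponent A) 0 → g c' = r) :
    branchSum M symmetrizeProg g c = r := by
  obtain ⟨h0, h5, h6⟩ := hc
  rw [symmetrizeProg, branchSum_seq, branchSum_of_run_eq (c' := c.assign 9 0) rfl,
    branchSum_seq, branchSum_of_run_eq (c' := (c.assign 9 0).assign 12 0) rfl, branchSum_seq,
    branchSum_of_run_eq (c' := ((c.assign 9 0).assign 12 0).assign 13 (c.reg 0 + c.reg 6)) rfl]
  have hn : (((c.assign 9 0).assign 12 0).assign 13 (c.reg 0 + c.reg 6)).reg 0 = n := by simp [h0]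
  refine branchSum_loop_eq (fun i c' => Ready n c' ∧ c'.reg 9 = i ∧ c'.reg 12 = i ∧
    c'.reg 13 = n + i ∧ c'.reg 4 = 1 ∧ c'.state = opState (swapAverages A i) 0)
    (fun c => c.reg 4 = 0) (fun _ _ => r) ?_ ?_ hg0 ?_ ?_
  · exact ⟨⟨by simp [h0], by simp [h5], by simp [h6]⟩, by simp, by simp, by simp [h0, h6],
      by simp [h4], by simp [hA, swapAverages]⟩
  · intro c₀ hc₀ c' hc'
    have := nonIncreasing_averageProg.reg_le _ c' hc'
    simpa [hc₀] using this
  · rw [hn]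
    rintro c' ⟨k, -, -, -, k4, ks⟩
    exact hg c' k k4 (by rw [ks, swapAverages_eq_permInvComponent])
  · rw [hn]
    rintro i hi g' hg0' hg' c' ⟨k, k9, k12, k13, k4, ks⟩
    obtain ⟨c₁, c₂, hrun, h₁, -, h41, h42, hs⟩ := exists_run_averageProg M (c := c'.tick 1)
      ⟨k.1, k.2, k.3⟩ ⟨i, hi⟩ k9 k12 k13
    -- In the failing branch the flag drops from `1` to `0`, so its payoff vanishes.
    rw [branchSum_of_run_eq_pair hrun, hg0' c₂ (by simp [h42, k4]), add_zero]
    refine hg' c₁ ⟨h₁.1, h₁.2, h₁.3, h₁.4, by simp [h41, k4], ?_⟩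
    rw [hs _ ks, swapAverages, dif_pos hi]

/-! ### Clearing the memory between rounds -/

/-- All quantum integers, the qudits before `j` and the qudits from `N` on are `0`. -/
def Cleared {d : ℕ} [NeZero d] (N j : ℕ) (ψ : QState d) : Prop :=
  ∀ b ∈ ψ.support, b.2 = (fun _ => 0) ∧ ∀ k, k < j ∨ N ≤ k → b.1 k = 0

theorem cleared_opState {d n : ℕ} [NeZero d] (A : Op d n) : Cleared (n + n) 0 (opState A 0) := by
  classical
  intro b hb
  obtain ⟨x, -, hx⟩ := Finset.mem_biUnion.1 (Finsupp.support_finsetSum hb)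
  obtain ⟨y, -, hy⟩ := Finset.mem_biUnion.1 (Finsupp.support_finsetSum hx)
  obtain rfl := Finset.mem_singleton.1 (Finsupp.support_single_subset hy)
  refine ⟨intVal_zero, fun k hk => pairQudits_of_le _ _ (by simpa using hk)⟩

theorem Cleared.setQudit_projQudit {d N j : ℕ} [NeZero d] {ψ : QState d} (h : Cleared N j ψ)
    (y : Fin d) : Cleared N (j + 1) (setQudit j 0 (projQudit j y ψ)) := by
  intro b hb
  obtain ⟨b', hb', rfl⟩ := mem_support_setQudit hb
  rw [projQudit, Finsupp.support_filter, Finset.mem_filter] at hb'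
  refine ⟨(h b' hb'.1).1, fun k hk => ?_⟩
  by_cases hkj : k = j
  · simp [hkj]
  · dsimp only
    rw [Function.update_of_ne hkj]
    exact (h b' hb'.1).2 k (by omega)

theorem Cleared.exists_eq_single {d N : ℕ} [NeZero d] {ψ : QState d} (h : Cleared N N ψ) :
    ∃ a, ψ = Finsupp.single (zeroBasis d) a := by
  refine ⟨ψ (zeroBasis d), Finsupp.support_subset_singleton.1 fun b hb => ?_⟩
  obtain ⟨h2, h1⟩ := h b hb
  exact Finset.mem_singleton.2 (Prod.ext (funext fun k => h1 k (lt_or_ge k N)) h2)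

theorem run_resetBody {d n : ℕ} [NeZero d] (M : Measurement d n) (c : Config d) :
    run M (.seq (.resetQ 7) (.add 7 7 5)) c = (List.finRange d).map fun y =>
      (c.apply 1 fun ψ => setQudit (c.reg 7) 0 (projQudit (c.reg 7) y ψ)).assign 7
        (c.reg 7 + c.reg 5) := by
  simp [run, List.flatMap_map, ← List.map_eq_flatMap]

theorem forall_run_resetLoop {d n : ℕ} [NeZero d] (M : Measurement d n) {c : Config d}
    (hc : Ready n c) : ∀ c' ∈ run M resetLoop c, Ready n c' ∧
      c'.time = c.time + 1 + n * 3 ∧ c'.queries = c.queries := by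
  have h0 := hc.reg_zero
  intro c' hc'
  have := forall_run_loop (fun i c' => Ready n c' ∧ c'.time = c.time + 1 + i * 3 ∧
    c'.queries = c.queries) ⟨⟨hc.1, hc.2, hc.3⟩, by simp, by simp⟩ ?_ c' hc'
  · rwa [h0] at this
  · rintro i - c' ⟨⟨k0, k5, k6⟩, kt, kq⟩ c'' hc''
    rw [run_resetBody] at hc''
    obtain ⟨y, -, rfl⟩ := List.mem_map.1 hc''
    exact ⟨⟨by simp [k0], by simp [k5], by simp [k6]⟩, by simp [kt]; ring, by simp [kq]⟩

theorem branchSum_resetLoop {d n : ℕ} [NeZero d] (M : Measurement d n) {c : Config d}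
    (hc : Ready n c) (h4 : c.reg 4 = 1) (hs : Cleared (n + n) (c.reg 7) c.state)
    {g : Config d → ℝ} {r : ℝ}
    (hg : ∀ c', Ready n c' → c'.reg 4 = 1 → c'.reg 7 = c.reg 7 + n →
      Cleared (n + n) (c'.reg 7) c'.state → g c' = c'.state.normSq * r) :
    branchSum M resetLoop g c = c.state.normSq * r := by
  have h0 := hc.reg_zero
  -- Resetting fails in no branch, so `Z` is empty; the value is proportional to the squared norm
  -- because the forgotten outcomes share out that norm.
  refine branchSum_loop_eq (fun i c' => Ready n c' ∧ c'.reg 4 = 1 ∧ c'.reg 7 = c.reg 7 + i ∧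
    Cleared (n + n) (c'.reg 7) c'.state) (fun _ => False) (fun _ c' => c'.state.normSq * r)
    ⟨⟨hc.1, hc.2, hc.3⟩, h4, rfl, hs⟩ (by simp) (by simp) ?_ ?_
  · rw [h0]
    rintro c' ⟨k, k4, k7, ks⟩
    exact hg c' k k4 k7 ks
  · rintro i - g' - hg' c' ⟨⟨k0, k5, k6⟩, k4, k7, ks⟩
    rw [branchSum, run_resetBody, List.map_map, ← Fin.sum_univ_def,
      ← sum_normSq_setQudit_projQudit (c'.reg 7) 0 c'.state, Finset.sum_mul]
    refine Finset.sum_congr rfl fun y _ => ?_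
    refine hg' _ ⟨⟨by simp [k0], by simp [k5], by simp [k6]⟩, by simp [k4],
      by simp [k7, k5, add_assoc], ?_⟩
    simpa [k5] using ks.setQudit_projQudit y

theorem branchSum_resetProg {d n : ℕ} [NeZero d] (M : Measurement d n) {c : Config d}
    (hc : Ready n c) (h4 : c.reg 4 = 1) {A : Op d n} (hA : c.state = opState A 0)
    {g : Config d → ℝ} {r : ℝ}
    (hg : ∀ c', Ready n c' → c'.reg 4 = 1 → (∃ a, c'.state = Finsupp.single (zeroBasis d) a) →
      g c' = c'.state.normSq * r) :
    branchSum M resetProg g c = frobSq A * r := by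
  obtain ⟨h0, h5, h6⟩ := hc
  rw [resetProg, branchSum_seq, branchSum_of_run_eq (c' := c.assign 7 0) rfl, branchSum_seq,
    ← normSq_opState A 0, ← hA]
  refine branchSum_resetLoop M ⟨by simp [h0], by simp [h5], by simp [h6]⟩ (by simp [h4])
    (by simpa [hA] using cleared_opState A) fun c' k k4 k7 ks => ?_
  refine branchSum_resetLoop M k k4 ks fun c'' l l4 l7 ls => hg c'' l l4 ?_
  rw [l7, k7] at ls
  simp only [Config.assign_reg, if_pos, zero_add] at ls
  exact ls.exists_eq_single

theorem forall_run_roundProg {d n : ℕ} [NeZero d] (M : Measurement d n) {c : Config d}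
    (hc : Ready n c) : ∀ c' ∈ run M roundProg c, Ready n c' ∧
      c'.time ≤ c.time + (7 * n ^ 2 + 30 * n + 11) ∧ c'.queries = c.queries + 1 := by
  obtain ⟨c₁, hrun, h₁, -, ht₁, hq₁, -⟩ := exists_run_prepareProg M hc
  rw [roundProg, run_seq_of_eq hrun]
  refine forall_run_seq (P := fun c' => Ready n c' ∧ c'.time = c.time + 4 + 5 * n ∧
    c'.queries = c.queries + 1) ?_ ?_
  · intro c' hc'
    simp only [run, List.mem_map] at hc'
    obtain ⟨i, -, rfl⟩ := hc'
    exact ⟨⟨by simp [h₁.1], by simp [h₁.2], by simp [h₁.3]⟩, by simp [ht₁]; ring, by simp [hq₁]⟩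
  rintro c₂ ⟨h₂, ht₂, hq₂⟩
  refine forall_run_seq (forall_run_symmetrizeProg M h₂) ?_
  rintro c₃ ⟨⟨h0, h5, h6⟩, ht₃, hq₃⟩
  rw [resetProg, run_seq_of_eq (c' := c₃.assign 7 0) rfl]
  refine forall_run_seq (forall_run_resetLoop M
    ⟨by simp [h0], by simp [h5], by simp [h6]⟩) ?_
  rintro c₄ ⟨h₄, ht₄, hq₄⟩ c₅ hc₅
  obtain ⟨h₅, ht₅, hq₅⟩ := forall_run_resetLoop M h₄ c₅ hc₅
  simp only [Config.assign_time, Config.assign_queries] at ht₄ hq₄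
  refine ⟨h₅, ?_, by omega⟩
  nlinarith

theorem nonIncreasing_roundProg : roundProg.NonIncreasing 4 := by
  simp [roundProg, prepareProg, symmetrizeProg, resetProg, resetLoop, averageProg, selectSwapProg,
    Prog.NonIncreasing]

theorem branchSum_eq_zero_of_nonIncreasing {d n : ℕ} [NeZero d] {M : Measurement d n} {p : Prog}
    {a : ℕ} (hp : p.NonIncreasing a) {g : Config d → ℝ} (hg : ∀ c, c.reg a = 0 → g c = 0)
    {c : Config d} (hc : c.reg a = 0) : branchSum M p g c = 0 :=
  branchSum_eq_zero fun c' hc' => hg c' (by simpa [hc] using hp.reg_le c c' hc')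

/-- A round ends in a multiple of the zero state, so its only effect on later payoffs is the factor
`M.invWeight`; this is what makes the rounds independent. -/
theorem branchSum_roundProg {d n : ℕ} [NeZero d] (M : Measurement d n) {c : Config d}
    (hc : Ready n c) (h4 : c.reg 4 = 1) {a : ℂ} (ha : c.state = Finsupp.single (zeroBasis d) a)
    {g : Config d → ℝ} {r : ℝ} (hg0 : ∀ c, c.reg 4 = 0 → g c = 0)
    (hg : ∀ c', Ready n c' → c'.reg 4 = 1 → (∃ a, c'.state = Finsupp.single (zeroBasis d) a) →
      g c' = c'.state.normSq * r) :
    branchSum M roundProg g c = c.state.normSq * (M.invWeight * r) := by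
  obtain ⟨c₁, hrun, h₁, h₁4, -, -, hs₁⟩ := exists_run_prepareProg M hc
  have hreset : resetProg.NonIncreasing 4 := nonIncreasing_roundProg.2.2.2
  rw [roundProg, branchSum_seq, branchSum_of_run_eq hrun, branchSum_seq, branchSum, run,
    List.map_map]
  -- The amplitude `a` left by earlier rounds, times `1/√D` from the entangled pairs.
  set s : ℂ := a * (Real.sqrt d : ℂ)⁻¹ ^ n with hs
  have hterm : ∀ i, branchSum M (.seq symmetrizeProg resetProg) g
      { (c₁.apply 0 (applyOp (M.kraus i))).assign 14 i with queries := c₁.queries + 1 } =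
      ‖s‖ ^ 2 * frobSq (permInvComponent (M.kraus i)) * r := by
    intro i
    rw [branchSum_seq]
    refine branchSum_symmetrizeProg M (A := s • M.kraus i)
      ⟨by simp [h₁.1], by simp [h₁.2], by simp [h₁.3]⟩ (by simp [h₁4, h4]) ?_
      (fun c hc => branchSum_eq_zero_of_nonIncreasing hreset hg0 hc) fun c' k k4 ks => ?_
    · simp only [Config.assign_state, Config.apply_state, hs₁ a ha, applyOp_opState,
        Matrix.mul_smul, Matrix.mul_one, hs]
    · rw [branchSum_resetProg M k k4 ks hg]
      congr 1
      have : permInvComponent (s • M.kraus i) = s • permInvComponent (M.kraus i) := by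
        simp only [permInvComponent, Matrix.mul_smul, Matrix.smul_mul, ← Finset.smul_sum]
        rw [smul_comm]
      rw [this, frobSq_smul]
  have hsum : ∀ f : ℕ → ℝ, ((List.range M.outcomes).map f).sum =
      ∑ i ∈ Finset.range M.outcomes, f i := fun f => rfl
  rw [hsum]
  simp only [Function.comp_def]
  rw [Finset.sum_congr rfl fun i _ => hterm i, ← Finset.sum_mul, ← Finset.mul_sum,
    ← mul_assoc]
  congr 1
  have hnorm : ‖s‖ ^ 2 = c.state.normSq * (1 / dimD d n) := by
    have : c.state.normSq = ‖a‖ ^ 2 := by simp [ha, QState.normSq]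
    rw [this, hs, norm_mul, mul_pow, norm_pow, norm_inv, Complex.norm_real, Real.norm_eq_abs,
      abs_of_nonneg (Real.sqrt_nonneg _), ← pow_mul, mul_comm n, pow_mul, inv_pow,
      Real.sq_sqrt (Nat.cast_nonneg _), dimD, inv_pow, one_div]
  rw [hnorm, Measurement.invWeight, mul_assoc]

/-! ### All rounds together: queries, time and acceptance probability -/

/-- The number of rounds of the tester. -/
def rounds (ε : ℝ) : ℕ := 2 * ⌈1 / ε⌉₊ ^ 2

/-- The configuration in which the rounds of the tester start. -/
theorem exists_run_testerProg {d n : ℕ} [NeZero d] (ε : ℝ) (M : Measurement d n) :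
    ∃ c : Config d, run M testerProg (initConfig d n ε) =
        run M (.seq (.loop 3 roundProg) (.sub 0 4 6)) c ∧ Ready n c ∧ c.reg 3 = rounds ε ∧
      c.reg 4 = 1 ∧ c.state = Finsupp.single (zeroBasis d) 1 ∧
      c.time = 4 + 2 * ⌈1 / ε⌉₊ ∧ c.queries = 0 := by
  set k := ⌈1 / ε⌉₊ with hk
  obtain ⟨c, hrun, h0, h2, h3, h6, hs, ht, hq⟩ := exists_run_loop_eq (M := M) (x := 2)
    (p := .add 3 3 2) (c := initConfig d n ε)
    (fun i c => c.reg 0 = n ∧ c.reg 2 = k ∧ c.reg 3 = i * k ∧ c.reg 6 = 0 ∧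
      c.state = Finsupp.single (zeroBasis d) 1 ∧ c.time = 1 + 2 * i ∧ c.queries = 0)
    ⟨rfl, rfl, by simp [initConfig], rfl, rfl, rfl, rfl⟩ (by
      rintro i - c ⟨h0, h2, h3, h6, hs, ht, hq⟩
      exact ⟨_, rfl, by simp [h0], by simp [h2], by simp [h3, h2, add_one_mul], by simp [h6],
        by simp [hs], by simp [ht]; ring, by simp [hq]⟩)
  have hreg : (initConfig d n ε).reg 2 = k := rfl
  rw [hreg] at h3 ht
  refine ⟨((c.assign 3 (c.reg 3 + c.reg 3)).assign 4 1).assign 5 1, ?_, ⟨by simp [h0], by simp,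
    by simp [h6]⟩, by simp only [Config.assign_reg, h3, rounds, ← hk]; simp; ring,
    by simp, by simp [hs], by simp [ht]; ring,
    by simp [hq]⟩
  rw [testerProg, run_seq_of_eq hrun, run_seq_of_eq (c' := c.assign 3 (c.reg 3 + c.reg 3)) rfl,
    run_seq_of_eq (c' := (c.assign 3 (c.reg 3 + c.reg 3)).assign 4 1) rfl, run_seq_of_eq rfl]

theorem forall_branches_testerProg {d n : ℕ} [NeZero d] (ε : ℝ) (M : Measurement d n) :
    ∀ c ∈ branches testerProg ε M, c.queries = rounds ε ∧
      c.time ≤ rounds ε * (7 * n ^ 2 + 30 * n + 12) + 2 * ⌈1 / ε⌉₊ + 6 := by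
  obtain ⟨c, hrun, hc, h3, -, -, ht, hq⟩ := exists_run_testerProg ε M
  rw [branches, hrun]
  refine forall_run_seq (forall_run_loop (fun i c' => Ready n c' ∧ c'.queries = i ∧
    c'.time ≤ 5 + 2 * ⌈1 / ε⌉₊ + i * (7 * n ^ 2 + 30 * n + 12))
    ⟨⟨hc.1, hc.2, hc.3⟩, by simp [hq], by simp [ht]⟩ ?_) ?_
  · rintro i - c' ⟨k, kq, kt⟩ c'' hc''
    obtain ⟨l, lt, lq⟩ := forall_run_roundProg M (c := c'.tick 1) ⟨k.1, k.2, k.3⟩ c'' hc''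
    simp only [Config.tick_time, Config.tick_queries] at lt lq
    refine ⟨l, by omega, ?_⟩
    rw [add_one_mul]
    omega
  · rw [h3]
    rintro c' ⟨-, kq, kt⟩ c'' hc''
    simp only [run, List.mem_singleton] at hc''
    subst hc''
    simp only [Config.assign_queries, Config.assign_time]
    exact ⟨kq, by omega⟩

theorem acceptProb_testerProg {d n : ℕ} [NeZero d] (ε : ℝ) (M : Measurement d n) :
    acceptProb testerProg ε M = M.invWeight ^ rounds ε := by
  obtain ⟨c, hrun, hc, h3, h4, hs, -, -⟩ := exists_run_testerProg ε M
  set g : Config d → ℝ := fun c => if c.reg 0 = 1 then c.state.normSq else 0 with hgdef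
  have hg : ∀ c : Config d, Ready n c → c.reg 4 = 1 →
      branchSum M (.sub 0 4 6) g c = c.state.normSq := fun c k k4 => by
    rw [branchSum_of_run_eq (c' := c.assign 0 (c.reg 4 - c.reg 6)) rfl]
    simp [hgdef, k4, k.reg_six]
  have hg0 : ∀ c : Config d, c.reg 4 = 0 → branchSum M (.sub 0 4 6) g c = 0 := fun c k4 => by
    rw [branchSum_of_run_eq (c' := c.assign 0 (c.reg 4 - c.reg 6)) rfl]
    simp [hgdef, k4]
  have hrun' : acceptProb testerProg ε M =
      branchSum M (.seq (.loop 3 roundProg) (.sub 0 4 6)) g c := by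
    rw [acceptProb, branches, hrun, branchSum]
  -- Before round `i`, a live branch is worth its weight times `M.invWeight` to the number of rounds
  -- left.
  rw [hrun', branchSum_seq, branchSum_loop_eq (fun _ c' => Ready n c' ∧ c'.reg 4 = 1 ∧
    ∃ a, c'.state = Finsupp.single (zeroBasis d) a) (fun c => c.reg 4 = 0)
    (fun i c' => c'.state.normSq * M.invWeight ^ (rounds ε - i))
    ⟨⟨hc.1, hc.2, hc.3⟩, h4, 1, hs⟩ ?_ hg0 ?_ ?_]
  · simp [hs, QState.normSq]
  · intro c₀ hc₀ c' hc'
    have := nonIncreasing_roundProg.reg_le _ c' hc'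
    simpa [hc₀] using this
  · rw [h3]
    rintro c' ⟨k, k4, -⟩
    rw [hg c' k k4, Nat.sub_self, pow_zero, mul_one]
  · rw [h3]
    rintro i hi g' hg0' hg' c' ⟨k, k4, a, ha⟩
    rw [branchSum_roundProg M (c := c'.tick 1) ⟨k.1, k.2, k.3⟩ k4 ha hg0'
      fun c'' l l4 ls => hg' c'' ⟨l, l4, ls⟩, ← pow_succ', Config.tick_state]
    congr 2
    omega

/-! ### Numerical bounds -/

theorem two_le_sq_mul_rounds {ε : ℝ} (hε : 0 < ε) : 2 ≤ ε ^ 2 * rounds ε := by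
  have h : 1 ≤ ε * ⌈1 / ε⌉₊ := by
    have := mul_le_mul_of_nonneg_left (Nat.le_ceil (1 / ε)) hε.le
    rwa [mul_one_div_cancel hε.ne'] at this
  have := pow_le_pow_left₀ zero_le_one h 2
  rw [rounds]
  push_cast
  nlinarith

theorem ceil_one_div_le {ε : ℝ} (hε : 0 < ε) (h1 : ε ≤ 1) :
    (⌈1 / ε⌉₊ : ℝ) ≤ 1 / ε + 1 ∧ (⌈1 / ε⌉₊ : ℝ) ≤ 2 / ε := by
  have h : (⌈1 / ε⌉₊ : ℝ) ≤ 1 / ε + 1 := (Nat.ceil_lt_add_one (by positivity)).le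
  have h2 : 1 ≤ 1 / ε := by rwa [le_div_iff₀ hε, one_mul]
  have h3 : 2 / ε = 1 / ε + 1 / ε := by ring
  exact ⟨h, by linarith⟩

theorem rounds_le {ε : ℝ} (hε : 0 < ε) (h1 : ε ≤ 1) : (rounds ε : ℝ) ≤ 8 / ε ^ 2 := by
  have := pow_le_pow_left₀ (Nat.cast_nonneg _) (ceil_one_div_le hε h1).2 2
  rw [rounds]
  push_cast
  calc _ ≤ 2 * (2 / ε) ^ 2 := by linarith
    _ = _ := by ring

theorem nat_le_logb_dimD {d : ℕ} (n : ℕ) (hd : 2 ≤ d) : (n : ℝ) ≤ Real.logb 2 (dimD d n) := by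
  have hd' : (2 : ℝ) ≤ d := by exact_mod_cast hd
  have : 1 ≤ Real.logb 2 d := by
    rw [Real.le_logb_iff_rpow_le (by norm_num) (by linarith), Real.rpow_one]
    exact hd'
  rw [dimD, Real.logb_pow]
  exact le_mul_of_one_le_right (Nat.cast_nonneg n) this

/-- A bound for the running time. -/
def timePoly : MvPolynomial (Fin 2) ℝ :=
  68 * (MvPolynomial.X 0 + 1) ^ 2 * (MvPolynomial.X 1 + 1) ^ 2

theorem timeAtMost_testerProg {d n : ℕ} [NeZero d] (hd : 2 ≤ d) {ε : ℝ} (hε : 0 < ε) (h1 : ε ≤ 1)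
    (M : Measurement d n) : TimeAtMost testerProg ε M
      (MvPolynomial.eval ![Real.logb 2 (dimD d n), 1 / ε] timePoly) := by
  intro c hc
  have ht : (c.time : ℝ) ≤ 2 * (⌈1 / ε⌉₊ : ℝ) ^ 2 * (7 * n ^ 2 + 30 * n + 12) +
      2 * ⌈1 / ε⌉₊ + 6 := by
    exact_mod_cast (forall_branches_testerProg ε M c hc).2
  have hx := nat_le_logb_dimD n hd
  have hk := (ceil_one_div_le hε h1).1
  have heval : MvPolynomial.eval ![Real.logb 2 (dimD d n), 1 / ε] timePoly =
      68 * (Real.logb 2 (dimD d n) + 1) ^ 2 * (1 / ε + 1) ^ 2 := by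
    simp [timePoly]
  rw [heval]
  set x := Real.logb 2 (dimD d n)
  set y := 1 / ε
  have hn0 : (0 : ℝ) ≤ n := Nat.cast_nonneg n
  have hk0 : (0 : ℝ) ≤ ⌈y⌉₊ := Nat.cast_nonneg _
  have hy0 : 0 ≤ y := by positivity
  have hk2 : (⌈y⌉₊ : ℝ) ^ 2 ≤ (y + 1) ^ 2 := pow_le_pow_left₀ hk0 hk 2
  have hx2 : ((n : ℝ) + 1) ^ 2 ≤ (x + 1) ^ 2 := pow_le_pow_left₀ (by positivity) (by linarith) 2
  have hx1 : (1 : ℝ) ≤ (x + 1) ^ 2 := by nlinarith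
  have hsmall : 2 * (⌈y⌉₊ : ℝ) + 6 ≤ 8 * (y + 1) ^ 2 := by nlinarith
  calc _ ≤ 2 * (⌈y⌉₊ : ℝ) ^ 2 * (7 * n ^ 2 + 30 * n + 12) + 2 * ⌈y⌉₊ + 6 := ht
    -- `7 n² + 30 n + 12 ≤ 30 (n + 1)²`; the constant of `timePoly` is `2 · 30 + 8`.
    _ ≤ 2 * (y + 1) ^ 2 * (30 * (x + 1) ^ 2) + 8 * (y + 1) ^ 2 * (x + 1) ^ 2 := by
      rw [add_assoc]
      refine add_le_add ?_ (hsmall.trans (le_mul_of_one_le_right (by positivity) hx1))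
      exact mul_le_mul (by linarith) (by nlinarith) (by positivity) (by positivity)
    _ = _ := by ring

end QMeasTest

end

theorem mainTheorem3 :
    ∃ (p : QMeasTest.Prog) (C : ℝ) (P : MvPolynomial (Fin 2) ℝ),
      ∀ (d n : ℕ) [NeZero d], 2 ≤ d → ∀ ε : ℝ, 0 < ε → ε ≤ 1 →
        ∃ L : ℕ, (L : ℝ) ≤ C / ε ^ 2 ∧
          QMeasTest.EpsTests p ε (QMeasTest.permInvMeasurements d n) L ∧
          ∀ M : QMeasTest.Measurement d n,
            QMeasTest.acceptProb p ε M =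
              (1 / QMeasTest.dimD d n * ∑ i ∈ Finset.range M.outcomes,
                QMeasTest.frobSq (QMeasTest.permInvComponent (M.kraus i))) ^ L ∧
            QMeasTest.TimeAtMost p ε M
              (MvPolynomial.eval ![Real.logb 2 (QMeasTest.dimD d n), 1 / ε] P) := by
  -- The constant `8` comes from `⌈1/ε⌉ ≤ 2/ε` for `ε ≤ 1`, so that `2⌈1/ε⌉² ≤ 8/ε²`.
  refine ⟨QMeasTest.testerProg, 8, QMeasTest.timePoly, fun d n _ hd ε hε h1 =>
    ⟨QMeasTest.rounds ε, QMeasTest.rounds_le hε h1, fun M => ⟨fun c hc =>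
      (QMeasTest.forall_branches_testerProg ε M c hc).1.le, fun hM => ?_, fun hM => ?_⟩,
      fun M => ⟨QMeasTest.acceptProb_testerProg ε M,
        QMeasTest.timeAtMost_testerProg hd hε h1 M⟩⟩⟩
  · rw [QMeasTest.acceptProb_testerProg, QMeasTest.Measurement.invWeight_eq_one hM, one_pow]
    norm_num
  · rw [QMeasTest.acceptProb_testerProg]
    exact QMeasTest.Measurement.invWeight_pow_le hε.le hM (QMeasTest.two_le_sq_mul_rounds hε)
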